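/- Let $B_n$ be the Bernoulli numbers ($B_1=-\tfrac12$), let $|S_1(n,l)|$ be the unsigned Stirling numbers of the first kind, $z(z+1)\cdots(z+n-1)=\sum_l |S_1(n,l)|\,z^l$, let $\gamma$ be Euler's constant, and let $\gamma_m$ ($m\ge 0$) be the Stieltjes constants, defined by $$\zeta(s)=\frac1{s-1}+\sum_{m=0}^\infty\frac{(-1)^m(s-1)^m}{m!}\,\gamma_m\qquad(s\ne1).$$ For $m\ge0$, $k\ge1$ and $N\ge 0$ put $$T_m(k)=\frac{(-1)^m\,m!\,|S_1(2k,m+1)|\,B_{2k}}{(2k)!},\qquad P_m(N)=\sum_{k=1}^{N}T_m(k).$$ Then the following hold. 1. For every $m\ge0$: $|S_1(m+1,m+1)|=1$, $|S_1(m+2,m+1)|=\frac12(m+1)(m+2)$, $|S_1(m+3,m+1)|=\frac1{24}(m+1)(m+2)(m+3)(3m+8)$, and $|S_1(m+4,m+1)|=\frac1{48}(m+1)(m+2)(m+3)^2(m+4)^2$. 2. For $m\ge0$ and $k\ge1$, $T_m(k)\neq0$ if and only if $k\ge k_m$, where $k_m=\lceil (m+1)/2\rceil$. 3. The following rational bounds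 hold; in each of them one bound equals $P_m(k_m)$ and the other equals $P_m(k_m+1)$, the first two nonvanishing partial sums: $$-\frac{|B_{m+1}|}{m+1}<\gamma_m<\frac{(3m+8)|B_{m+3}|}{24}-\frac{|B_{m+1}|}{m+1},\qquad m=1,5,9,\dots,$$ where the lower bound is $P_m(k_m)$; $$\frac{|B_{m+1}|}{m+1}-\frac{(3m+8)|B_{m+3}|}{24}<\gamma_m<\frac{|B_{m+1}|}{m+1},\qquad m=3,7,11,\dots,$$ where the upper bound is $P_m(k_m)$; $$-\frac{|B_{m+2}|}{2}<\gamma_m<\frac{(m+3)(m+4)|B_{m+4}|}{48}-\frac{|B_{m+2}|}{2},\qquad m=2,6,10,\dots,$$ where the lower bound is $P_m(k_m)$; $$\frac{|B_{m+2}|}{2}-\frac{(m+3)(m+4)|B_{m+4}|}{48}<\gamma_m-\frac12\delta_{m,0}<\frac{|B_{m+2}|}{2},\qquad m=0,4,8,12,\dots,$$ where the upper bound is $P_m(k_m)$, and $\delta_{m,0}$ is $1$ for $m=0$ and $0$ otherwise. 4. In particular, $\frac{23}{40}<\gamma<\frac{7}{12}$. -/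

import Mathlib

/-- The Stieltjes constant (generalized Euler constant) `γ_m`, defined through the Laurent expansion
`ζ(s) = 1 / (s - 1) + ∑ (-1) ^ m * γ_m * (s - 1) ^ m / m!` of the Riemann zeta function at `s = 1`.
Here `riemannZeta₀` is Mathlib's entire function that equals `ζ(s) - 1 / (s - 1)` off `s = 1`.
The derivatives are real (`ofReal_stieltjesConstant`), and the expansion is
`hasSum_stieltjesConstant`. -/
noncomputable def stieltjesConstant (m : ℕ) : ℝ :=
  ((-1) ^ m * iteratedDeriv m riemannZeta₀ 1).re

theorem iteratedDeriv_riemannZeta₀_conj (m : ℕ) (s : ℂ) :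
    iteratedDeriv m riemannZeta₀ (starRingEnd ℂ s)
      = starRingEnd ℂ (iteratedDeriv m riemannZeta₀ s) := by
  induction m generalizing s with
  | zero =>
    by_cases hs : s = 1
    · simp [hs]
    · have hs' : starRingEnd ℂ s ≠ 1 := fun h => hs (by simpa using congrArg (starRingEnd ℂ) h)
      simp [riemannZeta₀, hs, hs', riemannZeta_conj]
  | succ n ih =>
    have hfun : iteratedDeriv n riemannZeta₀
        = starRingEnd ℂ ∘ iteratedDeriv n riemannZeta₀ ∘ starRingEnd ℂ := by
      funext z
      simp [ih]
    rw [iteratedDeriv_succ]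
    conv_lhs => rw [hfun]
    rw [deriv_conj_conj]
    simp

theorem ofReal_stieltjesConstant (m : ℕ) :
    (stieltjesConstant m : ℂ) = (-1) ^ m * iteratedDeriv m riemannZeta₀ 1 := by
  unfold stieltjesConstant
  apply Complex.conj_eq_iff_re.mp
  rw [map_mul, ← iteratedDeriv_riemannZeta₀_conj]
  simp

/-- The Laurent expansion of `ζ` at `s = 1`. -/
theorem hasSum_stieltjesConstant {s : ℂ} (hs : s ≠ 1) :
    HasSum (fun m : ℕ => (-1) ^ m * (s - 1) ^ m / (m.factorial : ℂ) * (stieltjesConstant m : ℂ))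
      (riemannZeta s - 1 / (s - 1)) := by
  have h := Complex.hasSum_taylorSeries_of_entire differentiable_riemannZeta₀ 1 s
  have e : riemannZeta₀ s = riemannZeta s - 1 / (s - 1) := by
    simp [riemannZeta₀, hs]
  rw [e] at h
  have hfun : (fun m : ℕ => (-1) ^ m * (s - 1) ^ m / (m.factorial : ℂ) * (stieltjesConstant m : ℂ))
      = fun m : ℕ => ((m.factorial : ℂ)⁻¹) • (s - 1) ^ m • iteratedDeriv m riemannZeta₀ 1 := by
    funext m
    have h1 : ((-1 : ℂ) ^ m) * (-1) ^ m = 1 := by rw [← mul_pow]; simp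
    rw [ofReal_stieltjesConstant, smul_eq_mul, smul_eq_mul]
    linear_combination ((s - 1) ^ m / (m.factorial : ℂ) * iteratedDeriv m riemannZeta₀ 1) * h1
  rw [hfun]
  exact h

theorem stieltjesConstant_zero : stieltjesConstant 0 = Real.eulerMascheroniConstant := by
  simp [stieltjesConstant]

/-- The `k`-th term `(-1) ^ m * m! * |S₁(2k, m + 1)| * B_{2k} / (2k)!` (`k = 1, 2, 3, …`) of the
formal series of rational numbers attached to `γ_m - δ_{m,0} / 2`. `Nat.stirlingFirst` is the
unsigned Stirling number of the first kind. -/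
def stieltjesTerm (m k : ℕ) : ℚ :=
  (-1) ^ m * (m.factorial : ℚ) * (Nat.stirlingFirst (2 * k) (m + 1) : ℚ) * bernoulli (2 * k)
    / ((2 * k).factorial : ℚ)

/-- The partial sum over `k = 1, …, N` of the formal series attached to `γ_m - δ_{m,0} / 2`. -/
def stieltjesPartialSum (m N : ℕ) : ℚ :=
  ∑ k ∈ Finset.Icc 1 N, stieltjesTerm m k

/-! Write w(x) = 1/(e^{2πx} - 1) and f_m(x) = -2 Im(log(1+ix)^m / (1+ix)) (`jensenFun`). Everything
rests on the Jensen–Franel representation γ_m - δ_{m,0}/2 = ∫_0^∞ w f_m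
(`stieltjesConstant_eq_integral`). It follows from Hermite's formula for ζ(s) - 1/(s-1) - 1/2 at s =
1 + y: expand (1+ix)^{-s} in powers of y and compare coefficients. Hermite's formula itself is the
double integral of w(x) t^{s-1} e^{-t} sin(tx), evaluated in both orders.

The odd moments of w are ∫ w x^{2k-1} = |B_{2k}|/(4k). The Taylor coefficients of f_m are Stirling
numbers up to elementary factors, so its series formally integrates to the sum of the T_m(k). This
is only a guide; the bounds come from pointwise inequalities.

The estimates |f_m| < 2x^m for m odd and |f_m| < (m+2)x^{m+1} for m even integrate to |γ_m -
δ_{m,0}/2| < |T_m(k_m)|. One side of this is the bound P_m(k_m). For m ≥ 3 the other side implies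
the bound P_m(k_m+1), because T_m(k_m+1) has the opposite sign to T_m(k_m) and, by the growth of the
Bernoulli numbers, at least twice its size (`two_mul_first_term_le_odd`,
`two_mul_first_term_le_even`). For m = 0, 1, 2 this factor two fails, and f_m is compared with its
two-term Taylor polynomial instead. -/

open MeasureTheory Set Filter Topology

/-! ### The Planck kernel: decay and moments -/

/-- The Planck kernel `1 / (exp (2 * π * x) - 1)`. -/
noncomputable def planckKernel (x : ℝ) : ℝ := (Real.exp (2 * Real.pi * x) - 1)⁻¹

/-- The right side is 2 e^{πx} sinh(πx), and u ≤ sinh u for u ≥ 0. -/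
theorem exp_two_pi_mul_sub_one_ge {x : ℝ} (hx : 0 < x) :
    2 * Real.pi * x * Real.exp (Real.pi * x) ≤ Real.exp (2 * Real.pi * x) - 1 := by
  have h0 : 0 < Real.pi * x := mul_pos Real.pi_pos hx
  have h := Real.self_le_sinh_iff.mpr h0.le
  rw [Real.sinh_eq] at h
  have e1 : Real.exp (2 * Real.pi * x) = Real.exp (Real.pi * x) * Real.exp (Real.pi * x) := by
    rw [← Real.exp_add]; ring_nf
  have e2 : Real.exp (Real.pi * x) * Real.exp (-(Real.pi * x)) = 1 := by
    rw [← Real.exp_add]; simp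
  have := Real.exp_pos (Real.pi * x)
  nlinarith

theorem planckKernel_pos {x : ℝ} (hx : 0 < x) : 0 < planckKernel x := by
  have := Real.pi_pos
  have h : 1 < Real.exp (2 * Real.pi * x) := Real.one_lt_exp_iff.mpr (by positivity)
  exact inv_pos.mpr (by linarith)

/-- A factor `x` cancels the simple pole of the kernel at 0 and leaves exponential decay; the
dominations involving the kernel rest on this. -/
theorem planckKernel_mul_le {x : ℝ} (hx : 0 < x) :
    planckKernel x * x ≤ Real.exp (-Real.pi * x) := by
  have := Real.pi_gt_three
  have h := exp_two_pi_mul_sub_one_ge hx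
  have h2 : 0 < 2 * Real.pi * x * Real.exp (Real.pi * x) := by positivity
  have h3 : 0 < Real.exp (2 * Real.pi * x) - 1 := by linarith
  have e : Real.exp (-Real.pi * x) = (Real.exp (Real.pi * x))⁻¹ := by rw [← Real.exp_neg]; ring_nf
  rw [planckKernel, e, ← one_div, div_mul_eq_mul_div, one_mul, div_le_iff₀ h3]
  calc x ≤ 2 * Real.pi * x := by nlinarith
    _ = (Real.exp (Real.pi * x))⁻¹ * (2 * Real.pi * x * Real.exp (Real.pi * x)) := by
      field_simp
    _ ≤ _ := by gcongr

theorem measurable_planckKernel : Measurable planckKernel := by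
  unfold planckKernel; fun_prop

theorem integrableOn_planckKernel_mul_pow {j : ℕ} (hj : j ≠ 0) :
    IntegrableOn (fun x => planckKernel x * x ^ j) (Ioi 0) := by
  obtain ⟨j, rfl⟩ := Nat.exists_eq_succ_of_ne_zero hj
  have h := integrableOn_rpow_mul_exp_neg_mul_rpow (s := j) (p := 1) (b := Real.pi)
    (by have : (0 : ℝ) ≤ j := by positivity
        linarith) one_pos Real.pi_pos
  refine Integrable.mono' h (measurable_planckKernel.mul (by fun_prop)).aestronglyMeasurable ?_
  refine (ae_restrict_iff' measurableSet_Ioi).mpr (ae_of_all _ fun x (hx : 0 < x) => ?_)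
  have := planckKernel_mul_le hx
  have h0 := planckKernel_pos hx
  rw [Real.norm_of_nonneg (by positivity), Real.rpow_natCast, Real.rpow_one, pow_succ]
  calc _ = x ^ j * (planckKernel x * x) := by ring
    _ ≤ _ := by gcongr

theorem hasSum_planckKernel {x : ℝ} (hx : 0 < x) :
    HasSum (fun n : ℕ => Real.exp (-(2 * Real.pi * (n + 1)) * x)) (planckKernel x) := by
  have := Real.pi_pos
  have h1 : Real.exp (-(2 * Real.pi * x)) < 1 := by
    rw [Real.exp_lt_one_iff]; nlinarith [mul_pos this hx]
  have h := (hasSum_geometric_of_lt_one (Real.exp_pos _).le h1).mul_left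
    (Real.exp (-(2 * Real.pi * x)))
  convert! h using 1
  · funext n
    rw [← Real.exp_nat_mul, ← Real.exp_add]
    ring_nf
  · rw [planckKernel, Real.exp_neg]
    have : Real.exp (2 * Real.pi * x) ≠ 0 := (Real.exp_pos _).ne'
    rw [← mul_inv]
    congr 1
    field_simp

/-- Sign and size of B_{2k} are both read off Euler's formula for ζ(2k), since ζ(2k) ≥ 0. -/
theorem abs_bernoulli_two_mul (k : ℕ) (hk : k ≠ 0) :
    (bernoulli (2 * k) : ℝ) = (-1) ^ (k + 1) * |(bernoulli (2 * k) : ℝ)| ∧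
    |(bernoulli (2 * k) : ℝ)| * (2 ^ (2 * k - 1) * Real.pi ^ (2 * k) / (2 * k).factorial)
      = ∑' n : ℕ, 1 / (n : ℝ) ^ (2 * k) := by
  have hZ := hasSum_zeta_nat hk
  have hpi := Real.pi_pos
  have hC : 0 < 2 ^ (2 * k - 1) * Real.pi ^ (2 * k) / (2 * k).factorial := by positivity
  have hZ' : (-1 : ℝ) ^ (k + 1) * bernoulli (2 * k)
      * (2 ^ (2 * k - 1) * Real.pi ^ (2 * k) / (2 * k).factorial)
      = ∑' n : ℕ, 1 / (n : ℝ) ^ (2 * k) := by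
    rw [hZ.tsum_eq]; ring
  have h0 : 0 ≤ (-1 : ℝ) ^ (k + 1) * bernoulli (2 * k) := by
    refine nonneg_of_mul_nonneg_left ?_ hC
    rw [hZ']
    exact tsum_nonneg fun n => by positivity
  have habs : |(bernoulli (2 * k) : ℝ)| = (-1 : ℝ) ^ (k + 1) * bernoulli (2 * k) := by
    rw [← abs_of_nonneg h0, abs_mul, abs_pow]; simp
  have hsq : (-1 : ℝ) ^ (k + 1) * (-1) ^ (k + 1) = 1 := by rw [← mul_pow]; simp
  refine ⟨?_, by rw [habs, hZ']⟩
  rw [habs]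
  linear_combination (-(bernoulli (2 * k) : ℝ)) * hsq

/-- Expanding the kernel as a geometric series turns the moment into a sum of Gamma integrals, that
is, a multiple of ζ(2k), which Euler's formula evaluates. -/
theorem integral_planckKernel_mul_pow (k : ℕ) (hk : k ≠ 0) :
    ∫ x in Ioi (0 : ℝ), planckKernel x * x ^ (2 * k - 1) = |(bernoulli (2 * k) : ℝ)| / (4 * k) := by
  obtain ⟨k, rfl⟩ := Nat.exists_eq_succ_of_ne_zero hk
  have hpi := Real.pi_pos
  have hint : ∀ n : ℕ, ∫ x in Ioi (0 : ℝ), Real.exp (-(2 * Real.pi * (n + 1)) * x)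
      * x ^ (2 * k + 1) = (2 * k + 1).factorial / (2 * Real.pi * (n + 1)) ^ (2 * k + 2) := by
    intro n
    have h := Real.integral_rpow_mul_exp_neg_mul_Ioi (a := 2 * k + 2) (r := 2 * Real.pi * (n + 1))
      (by positivity) (by positivity)
    have e : ((2 : ℝ) * k + 2) = ((2 * k + 1 : ℕ) : ℝ) + 1 := by push_cast; ring
    rw [e, Real.Gamma_nat_eq_factorial, add_sub_cancel_right] at h
    have e' : (((2 * k + 1 : ℕ) : ℝ) + 1) = ((2 * k + 2 : ℕ) : ℝ) := by push_cast; ring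
    rw [e'] at h
    simp only [Real.rpow_natCast] at h
    rw [div_eq_mul_one_div, ← one_div_pow, mul_comm _ ((1 / _ : ℝ) ^ _), ← h]
    refine setIntegral_congr_fun measurableSet_Ioi fun x _ => ?_
    simp only [neg_mul]
    ring
  have hS := hasSum_integral_of_dominated_convergence (μ := volume.restrict (Ioi (0 : ℝ)))
    (F := fun (n : ℕ) x => Real.exp (-(2 * Real.pi * (n + 1)) * x) * x ^ (2 * k + 1))
    (f := fun x => planckKernel x * x ^ (2 * k + 1))
    (fun n x => Real.exp (-(2 * Real.pi * (n + 1)) * x) * x ^ (2 * k + 1))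
    (fun n => by fun_prop)
    (fun n => (ae_restrict_iff' measurableSet_Ioi).mpr (ae_of_all _ fun x (hx : 0 < x) => by
      rw [Real.norm_of_nonneg (by positivity)]))
    ((ae_restrict_iff' measurableSet_Ioi).mpr (ae_of_all _ fun x (hx : 0 < x) =>
      ((hasSum_planckKernel hx).mul_right _).summable))
    ((integrableOn_planckKernel_mul_pow (j := 2 * k + 1) (by omega)).congr_fun
      (fun x hx => ((hasSum_planckKernel hx).mul_right _).tsum_eq.symm) measurableSet_Ioi)
    ((ae_restrict_iff' measurableSet_Ioi).mpr (ae_of_all _ fun x (hx : 0 < x) =>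
      (hasSum_planckKernel hx).mul_right _))
  have hZ := hasSum_zeta_nat (k := k + 1) (by omega)
  -- The shift drops the term n = 0, which is 1/0 = 0.
  have hZ' := ((hasSum_nat_add_iff' 1).mpr hZ).mul_left
    ((2 * k + 1).factorial / (2 * Real.pi) ^ (2 * k + 2) : ℝ)
  have hval := hS.unique (hZ'.congr_fun fun n => ?_)
  swap
  · rw [hint]
    push_cast
    rw [mul_pow]
    field_simp
    ring_nf
  have habs : |(bernoulli (2 * (k + 1)) : ℝ)| = (-1 : ℝ) ^ (k + 1 + 1) * bernoulli (2 * (k + 1)) := by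
    have hsq : (-1 : ℝ) ^ (k + 1 + 1) * (-1) ^ (k + 1 + 1) = 1 := by rw [← mul_pow]; simp
    have h := (abs_bernoulli_two_mul (k + 1) (by omega)).1
    linear_combination (-1 : ℝ) ^ (k + 1 + 1) * -h - |(bernoulli (2 * (k + 1)) : ℝ)| * hsq
  rw [show 2 * (k + 1) - 1 = 2 * k + 1 by omega, hval, habs]
  simp only [Finset.range_one, Finset.sum_singleton, show 2 * (k + 1) - 1 = 2 * k + 1 by omega]
  have hf : ((2 * (k + 1)).factorial : ℝ) = (2 * k + 2) * (2 * k + 1).factorial := by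
    rw [show 2 * (k + 1) = 2 * k + 1 + 1 by ring, Nat.factorial_succ]
    push_cast
    ring
  rw [hf]
  have : ((2 * k + 1).factorial : ℝ) ≠ 0 := by positivity
  generalize ((2 * k + 1).factorial : ℝ) = f at *
  generalize (bernoulli (2 * (k + 1)) : ℝ) = b at *
  push_cast
  field_simp
  simp only [mul_pow]
  ring

/-! ### The sine transform of the Planck kernel -/

theorem integral_exp_neg_mul_mul_sin {a : ℝ} (ha : 0 < a) (t : ℝ) :
    ∫ x in Ioi (0 : ℝ), Real.exp (-a * x) * Real.sin (t * x) = t / (a ^ 2 + t ^ 2) := by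
  have hre : (-(a : ℂ) + t * Complex.I).re < 0 := by simpa using ha
  have h := integral_exp_mul_complex_Ioi hre 0
  have h' := congrArg Complex.im h
  have hi := integrableOn_exp_mul_complex_Ioi hre 0
  rw [← RCLike.im_eq_complex_im, ← integral_im hi] at h'
  have e : ∀ x : ℝ, RCLike.im (Complex.exp ((-(a : ℂ) + t * Complex.I) * x))
      = Real.exp (-a * x) * Real.sin (t * x) := fun x => by
    simp [Complex.exp_im]
  simp only [e] at h'
  rw [h']
  simp [Complex.div_im, Complex.normSq_apply]
  field_simp

/-- Termwise integration gives the sum of t/((2πn)² + t²) over n ≥ 1, which is the partial fraction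
expansion of the cotangent at it/(2π). -/
theorem integral_planckKernel_mul_sin {t : ℝ} (ht : 0 < t) :
    ∫ x in Ioi (0 : ℝ), planckKernel x * Real.sin (t * x)
      = (1 + Real.exp (-t)) / (1 - Real.exp (-t)) / 4 - 1 / (2 * t) := by
  have hpi := Real.pi_pos
  have hS := hasSum_integral_of_dominated_convergence (μ := volume.restrict (Ioi (0 : ℝ)))
    (F := fun (n : ℕ) x => Real.exp (-(2 * Real.pi * (n + 1)) * x) * Real.sin (t * x))
    (f := fun x => planckKernel x * Real.sin (t * x))
    -- Bounding |sin(tx)| by tx makes the majorants sum to an integrable function despite the pole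
    -- of the kernel.
    (fun n x => Real.exp (-(2 * Real.pi * (n + 1)) * x) * (t * x))
    (fun n => by fun_prop)
    (fun n => (ae_restrict_iff' measurableSet_Ioi).mpr (ae_of_all _ fun x (hx : 0 < x) => by
      rw [norm_mul, Real.norm_of_nonneg (Real.exp_pos _).le, Real.norm_eq_abs]
      gcongr
      exact Real.abs_sin_le_abs.trans_eq (abs_of_pos (by positivity))))
    ((ae_restrict_iff' measurableSet_Ioi).mpr (ae_of_all _ fun x (hx : 0 < x) =>
      ((hasSum_planckKernel hx).mul_right _).summable))
    (IntegrableOn.congr_fun (Integrable.const_mul (integrableOn_planckKernel_mul_pow one_ne_zero) t)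
      (fun x hx => by
        rw [((hasSum_planckKernel hx).mul_right _).tsum_eq]; ring) measurableSet_Ioi)
    ((ae_restrict_iff' measurableSet_Ioi).mpr (ae_of_all _ fun x (hx : 0 < x) =>
      (hasSum_planckKernel hx).mul_right _))
  have hz : Complex.I * t / (2 * Real.pi) ∈ Complex.integerComplement := by
    rw [Complex.mem_integerComplement_iff]
    rintro ⟨n, hn⟩
    have h1 := congrArg Complex.im hn
    have e : Complex.I * t / (2 * Real.pi) = ((t / (2 * Real.pi) : ℝ) : ℂ) * Complex.I := by
      push_cast; ring
    rw [e, Complex.im_ofReal_mul] at h1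
    have h2 : 0 < t / (2 * Real.pi) := by positivity
    simp at h1
    exact h2.ne' h1.symm
  have hcot := cot_series_rep' hz
  have hne : (1 : ℂ) - Complex.exp (-t) ≠ 0 := by
    have : Real.exp (-t) < 1 := by simpa using ht
    rw [← Complex.ofReal_neg, ← Complex.ofReal_exp, ← Complex.ofReal_one, ← Complex.ofReal_sub]
    exact Complex.ofReal_ne_zero.mpr (by linarith)
  have htC : (t : ℂ) ≠ 0 := Complex.ofReal_ne_zero.mpr ht.ne'
  have hpiC : (Real.pi : ℂ) ≠ 0 := Complex.ofReal_ne_zero.mpr hpi.ne'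
  rw [← hS.tsum_eq]
  simp only [integral_exp_neg_mul_mul_sin (show 0 < 2 * Real.pi * ((_ : ℕ) + 1) by positivity)]
  rw [← Complex.ofReal_inj, Complex.ofReal_tsum]
  have e : ∀ n : ℕ, ((t / ((2 * Real.pi * (n + 1)) ^ 2 + t ^ 2) : ℝ) : ℂ)
      = Complex.I / (4 * Real.pi) * (1 / (Complex.I * t / (2 * Real.pi) - (n + 1))
        + 1 / (Complex.I * t / (2 * Real.pi) + (n + 1))) := by
    intro n
    have h1 : Complex.I * t - 2 * Real.pi * (n + 1) ≠ 0 := fun h => ht.ne' (by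
      simpa using congrArg Complex.im h)
    have h2 : Complex.I * t + 2 * Real.pi * (n + 1) ≠ 0 := fun h => ht.ne' (by
      simpa using congrArg Complex.im h)
    have h3 : (2 * Real.pi * ((n : ℂ) + 1)) ^ 2 + (t : ℂ) ^ 2 ≠ 0 := by
      have : (2 * Real.pi * ((n : ℂ) + 1)) ^ 2 + (t : ℂ) ^ 2
        = -((Complex.I * t - 2 * Real.pi * (n + 1)) * (Complex.I * t + 2 * Real.pi * (n + 1))) := by
        linear_combination ((t : ℂ) ^ 2) * Complex.I_sq
      rw [this]
      exact neg_ne_zero.mpr (mul_ne_zero h1 h2)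
    have e1 : Complex.I * t / (2 * Real.pi) - (n + 1)
      = (Complex.I * t - 2 * Real.pi * (n + 1)) / (2 * Real.pi) := by field_simp
    have e2 : Complex.I * t / (2 * Real.pi) + (n + 1)
      = (Complex.I * t + 2 * Real.pi * (n + 1)) / (2 * Real.pi) := by field_simp
    rw [e1, e2]
    push_cast
    rw [one_div_div, one_div_div, div_add_div _ _ h1 h2, div_mul_div_comm,
      div_eq_div_iff h3 (by simp [hpiC, h1, h2])]
    linear_combination (-4 * (Real.pi : ℂ) * t * (2 * Real.pi * (n + 1)) ^ 2) * Complex.I_sq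
  simp only [e]
  rw [tsum_mul_left, ← hcot, Complex.cot_eq_exp_ratio]
  have e3 : 2 * Complex.I * (Real.pi * (Complex.I * t / (2 * Real.pi))) = -t := by
    field_simp
    rw [Complex.I_sq]
  rw [e3]
  push_cast
  have hI := Complex.I_ne_zero
  field_simp
  ring

/-! ### Gamma integrals with a complex rate -/

theorem integrableOn_rpow_mul_exp_neg {s : ℝ} (hs : 0 < s) :
    IntegrableOn (fun t : ℝ => t ^ (s - 1) * Real.exp (-t)) (Ioi 0) := by
  simpa only [mul_comm] using Real.GammaIntegral_convergent hs

/-- The Fourier transform of the density of the Gamma distribution. -/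
noncomputable def gammaFourier (s x : ℝ) : ℂ :=
  ∫ t in Ioi (0 : ℝ), ((t ^ (s - 1) * Real.exp (-t) : ℝ) : ℂ) * Complex.exp (-(x * t) * Complex.I)

theorem norm_gammaFourier_integrand {s t : ℝ} (ht : 0 < t) (x : ℝ) :
    ‖((t ^ (s - 1) * Real.exp (-t) : ℝ) : ℂ) * Complex.exp (-(x * t) * Complex.I)‖
      = t ^ (s - 1) * Real.exp (-t) := by
  have : -(x * t : ℂ) = ((-(x * t) : ℝ) : ℂ) := by push_cast; ring
  rw [norm_mul, this, Complex.norm_exp_ofReal_mul_I, mul_one, Complex.norm_real,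
    Real.norm_of_nonneg (by positivity)]

theorem integrableOn_gammaFourier {s : ℝ} (hs : 0 < s) (x : ℝ) :
    IntegrableOn (fun t : ℝ => ((t ^ (s - 1) * Real.exp (-t) : ℝ) : ℂ)
      * Complex.exp (-(x * t) * Complex.I)) (Ioi 0) := by
  refine Integrable.mono' (integrableOn_rpow_mul_exp_neg hs) (by fun_prop) ?_
  exact (ae_restrict_iff' measurableSet_Ioi).mpr (ae_of_all _ fun t (ht : 0 < t) =>
    (norm_gammaFourier_integrand ht x).le)

theorem hasDerivAt_gammaFourier {s : ℝ} (hs : 0 < s) (x : ℝ) :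
    HasDerivAt (gammaFourier s) (-Complex.I * gammaFourier (s + 1) x) x := by
  have h := (hasDerivAt_integral_of_dominated_loc_of_deriv_le
    (μ := volume.restrict (Ioi (0 : ℝ))) (𝕜 := ℝ) (s := univ) (x₀ := x)
    (F := fun (x t : ℝ) => ((t ^ (s - 1) * Real.exp (-t) : ℝ) : ℂ)
      * Complex.exp (-(x * t) * Complex.I))
    (F' := fun (x t : ℝ) => -Complex.I * (((t ^ (s + 1 - 1) * Real.exp (-t) : ℝ) : ℂ)
      * Complex.exp (-(x * t) * Complex.I)))
    (bound := fun t => t ^ (s + 1 - 1) * Real.exp (-t))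
    univ_mem (Eventually.of_forall fun y => by fun_prop) (integrableOn_gammaFourier hs x)
    (by fun_prop) ?_ (integrableOn_rpow_mul_exp_neg (by linarith)) ?_).2
  · rw [integral_const_mul] at h
    exact h
  · refine (ae_restrict_iff' measurableSet_Ioi).mpr (ae_of_all _ fun t (ht : 0 < t) y _ => ?_)
    rw [norm_mul, norm_gammaFourier_integrand ht]
    simp
  · refine (ae_restrict_iff' measurableSet_Ioi).mpr (ae_of_all _ fun t (ht : 0 < t) y _ => ?_)
    have h1 : HasDerivAt (fun y : ℝ => -((y : ℂ) * t) * Complex.I) (-((1 : ℂ) * t) * Complex.I) y :=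
      (((Complex.ofRealCLM.hasDerivAt (x := y)).mul_const (t : ℂ)).neg.mul_const Complex.I)
    have h2 := h1.cexp.const_mul ((t ^ (s - 1) * Real.exp (-t) : ℝ) : ℂ)
    convert! h2 using 1
    have : t ^ (s + 1 - 1) = t ^ (s - 1) * t := by
      rw [← Real.rpow_add_one ht.ne']; ring_nf
    rw [this]
    push_cast
    ring

/-- Integration by parts: the integrand on which the derivative acts is t^s e^{-(1+ix)t}, which
vanishes at both ends. -/
theorem one_add_mul_gammaFourier {s : ℝ} (hs : 0 < s) (x : ℝ) :
    (1 + x * Complex.I) * gammaFourier (s + 1) x = s * gammaFourier s x := by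
  have hi := ((integrableOn_gammaFourier hs x).const_mul (s : ℂ)).sub
    ((integrableOn_gammaFourier (show 0 < s + 1 by linarith) x).const_mul (1 + x * Complex.I))
  have h0 : ∀ t : ℝ, 0 ≤ t →
      ‖((t ^ s : ℝ) : ℂ) * Complex.exp (-(1 + x * Complex.I) * t)‖ = t ^ s * Real.exp (-t) := by
    intro t ht
    rw [norm_mul, Complex.norm_exp, Complex.norm_real, Real.norm_of_nonneg (by positivity)]
    simp
  have h := integral_Ioi_of_hasDerivAt_of_tendsto (a := 0) (m := 0)
    (f := fun t : ℝ => ((t ^ s : ℝ) : ℂ) * Complex.exp (-(1 + x * Complex.I) * t))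
    (f' := fun t : ℝ => s * (((t ^ (s - 1) * Real.exp (-t) : ℝ) : ℂ)
      * Complex.exp (-(x * t) * Complex.I)) - (1 + x * Complex.I) *
      (((t ^ (s + 1 - 1) * Real.exp (-t) : ℝ) : ℂ) * Complex.exp (-(x * t) * Complex.I)))
    ?_ ?_ hi ?_
  · rw [integral_sub ((integrableOn_gammaFourier hs x).const_mul (s : ℂ))
      ((integrableOn_gammaFourier (show 0 < s + 1 by linarith) x).const_mul (1 + x * Complex.I)),
      integral_const_mul, integral_const_mul] at h
    simp only [Real.zero_rpow hs.ne', Complex.ofReal_zero, zero_mul, sub_zero] at h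
    exact (sub_eq_zero.mp h).symm
  · apply Continuous.continuousWithinAt
    have : Continuous fun t : ℝ => t ^ s := Real.continuous_rpow_const hs.le
    fun_prop
  · intro t (ht : 0 < t)
    have h1 := (Real.hasDerivAt_rpow_const (p := s) (Or.inl ht.ne')).ofReal_comp
    have h2 : HasDerivAt (fun t : ℝ => Complex.exp (-(1 + x * Complex.I) * t))
        (Complex.exp (-(1 + x * Complex.I) * t) * (-(1 + x * Complex.I) * 1)) t :=
      ((Complex.ofRealCLM.hasDerivAt (x := t)).const_mul _).cexp
    convert! h1.mul h2 using 1
    have e : Complex.exp (-(1 + x * Complex.I) * t)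
        = Complex.exp (-t) * Complex.exp (-(x * t) * Complex.I) := by
      rw [← Complex.exp_add]; ring_nf
    rw [e, add_sub_cancel_right]
    push_cast
    ring
  · rw [tendsto_zero_iff_norm_tendsto_zero]
    refine (tendsto_congr' ?_).mpr (by
      simpa using tendsto_rpow_mul_exp_neg_mul_atTop_nhds_zero s 1 one_pos)
    filter_upwards [eventually_ge_atTop 0] with t ht
    exact h0 t ht

theorem one_add_mul_I_mem_slitPlane (x : ℝ) : 1 + (x : ℂ) * Complex.I ∈ Complex.slitPlane :=
  Or.inl (by simp)

/-- The derivative formula and the recurrence in `s` show that (1+ix)^s times the transform has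
derivative zero in `x`; at x = 0 it equals Γ(s). No contour rotation is needed. -/
theorem gammaFourier_eq {s : ℝ} (hs : 0 < s) (x : ℝ) :
    gammaFourier s x = Real.Gamma s * Complex.exp (-s * Complex.log (1 + x * Complex.I)) := by
  have hd : ∀ x : ℝ, HasDerivAt (fun x : ℝ =>
      Complex.exp (s * Complex.log (1 + x * Complex.I)) * gammaFourier s x) 0 x := by
    intro x
    have hne := Complex.slitPlane_ne_zero (one_add_mul_I_mem_slitPlane x)
    have h1 : HasDerivAt (fun x : ℝ => 1 + (x : ℂ) * Complex.I) ((1 : ℂ) * Complex.I) x :=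
      ((Complex.ofRealCLM.hasDerivAt (x := x)).mul_const Complex.I).const_add 1
    have h2 := ((h1.clog_real (one_add_mul_I_mem_slitPlane x)).const_mul (s : ℂ)).cexp.mul
      (hasDerivAt_gammaFourier hs x)
    convert! h2 using 1
    have h3 := one_add_mul_gammaFourier hs x
    field_simp
    linear_combination Complex.I * Complex.exp (s * Complex.log (1 + x * Complex.I)) * h3
  have hc := is_const_of_deriv_eq_zero (fun x => (hd x).differentiableAt)
    (fun x => (hd x).deriv) x 0
  have h0 : gammaFourier s 0 = Real.Gamma s := by
    rw [gammaFourier, Real.Gamma_eq_integral hs, ← integral_complex_ofReal]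
    simp [mul_comm]
  simp only [h0, Complex.ofReal_zero, zero_mul, add_zero, Complex.log_one, mul_zero,
    Complex.exp_zero, one_mul] at hc
  rw [← hc, mul_right_comm, ← Complex.exp_add]
  simp

theorem integral_rpow_mul_exp_neg_mul_sin {s : ℝ} (hs : 0 < s) (x : ℝ) :
    ∫ t in Ioi (0 : ℝ), t ^ (s - 1) * Real.exp (-t) * Real.sin (t * x)
      = Real.Gamma s * -(Complex.exp (-s * Complex.log (1 + x * Complex.I))).im := by
  have h := congrArg Complex.im (gammaFourier_eq hs x)
  rw [gammaFourier, ← RCLike.im_eq_complex_im, ← integral_im (integrableOn_gammaFourier hs x),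
    RCLike.im_eq_complex_im, Complex.im_ofReal_mul] at h
  rw [mul_neg, ← h, ← integral_neg]
  congr 1
  funext t
  rw [Complex.im_ofReal_mul, show -((x : ℂ) * t) = ((-(t * x) : ℝ) : ℂ) by push_cast; ring,
    Complex.exp_ofReal_mul_I_im, Real.sin_neg]
  ring

/-! ### Hermite's formula -/

theorem hasSum_exp_neg_succ_mul {t : ℝ} (ht : 0 < t) :
    HasSum (fun n : ℕ => Real.exp (-((n : ℝ) + 1) * t)) (Real.exp t - 1)⁻¹ := by
  have hpi := Real.pi_pos
  have h := hasSum_planckKernel (x := t / (2 * Real.pi)) (by positivity)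
  have e : 2 * Real.pi * (t / (2 * Real.pi)) = t := by field_simp
  rw [planckKernel, e] at h
  convert! h using 3
  field_simp

theorem integral_rpow_mul_inv_exp_sub_one {s : ℝ} (hs : 1 < s) :
    ((∫ t in Ioi (0 : ℝ), t ^ (s - 1) * (Real.exp t - 1)⁻¹ : ℝ) : ℂ)
      = Real.Gamma s * riemannZeta s := by
  have hs0 : 0 < s := by linarith
  have h := hasSum_mellin (a := fun _ : ℕ => (1 : ℂ)) (p := fun n => (n : ℝ) + 1)
    (F := fun t => (((Real.exp t - 1)⁻¹ : ℝ) : ℂ)) (s := s) (fun n => Or.inr (by positivity))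
    (by simpa using hs0) (fun t ht => ?_) ?_
  · have hz := zeta_eq_tsum_one_div_nat_add_one_cpow (s := s) (by simpa using hs)
    have h' := h.tsum_eq
    rw [hz, ← tsum_mul_left]
    rw [← integral_complex_ofReal]
    rw [mellin] at h'
    convert! h'.symm using 1
    · refine setIntegral_congr_fun measurableSet_Ioi fun t (ht : 0 < t) => ?_
      rw [Complex.ofReal_mul, Complex.ofReal_cpow ht.le]
      simp
    · congr 1
      funext n
      rw [Complex.Gamma_ofReal]
      push_cast
      ring
  · have := (hasSum_exp_neg_succ_mul ht).mapL Complex.ofRealCLM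
    simpa using this
  · simp only [norm_one, Complex.ofReal_re]
    have := (summable_nat_add_iff 1).mpr (Real.summable_one_div_nat_rpow.mpr hs)
    simpa using this

/-- Here 1/(e^t - 1) is the Planck kernel at t/(2π), so its decay estimate applies; the exponent s -
2 exceeds -1. -/
theorem integrableOn_rpow_mul_inv_exp_sub_one {s : ℝ} (hs : 1 < s) :
    IntegrableOn (fun t : ℝ => t ^ (s - 1) * (Real.exp t - 1)⁻¹) (Ioi 0) := by
  have hpi := Real.pi_pos
  have h := (integrableOn_rpow_mul_exp_neg_mul_rpow (s := s - 2) (p := 1) (b := 1 / 2)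
    (by linarith) one_pos (by norm_num)).const_mul (2 * Real.pi)
  refine Integrable.mono' h (by fun_prop) ?_
  refine (ae_restrict_iff' measurableSet_Ioi).mpr (ae_of_all _ fun t (ht : 0 < t) => ?_)
  have h1 := planckKernel_mul_le (x := t / (2 * Real.pi)) (by positivity)
  have h2 := planckKernel_pos (x := t / (2 * Real.pi)) (by positivity)
  have e : 2 * Real.pi * (t / (2 * Real.pi)) = t := by field_simp
  have e' : -Real.pi * (t / (2 * Real.pi)) = -(1 / 2) * t := by field_simp
  rw [planckKernel, e] at h1 h2
  rw [e'] at h1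
  rw [Real.norm_of_nonneg (by positivity), Real.rpow_one]
  calc t ^ (s - 1) * (Real.exp t - 1)⁻¹
      = 2 * Real.pi * (t ^ (s - 2) * ((Real.exp t - 1)⁻¹ * (t / (2 * Real.pi)))) := by
        have : t ^ (s - 1) = t ^ (s - 2) * t := by rw [← Real.rpow_add_one ht.ne']; ring_nf
        rw [this]
        field_simp
    _ ≤ _ := by gcongr

/-- With |sin(tx)| ≤ tx the majorant is a product of a function of `x` and a function of `t`, which
justifies Fubini. -/
theorem integrable_planckKernel_mul_gamma_sin {s : ℝ} (hs : 0 < s) :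
    Integrable (Function.uncurry fun x t : ℝ =>
      planckKernel x * (t ^ (s - 1) * Real.exp (-t) * Real.sin (t * x)))
      ((volume.restrict (Ioi 0)).prod (volume.restrict (Ioi 0))) := by
  have hb := (integrableOn_planckKernel_mul_pow one_ne_zero).mul_prod
    (integrableOn_rpow_mul_exp_neg (show 0 < s + 1 by linarith))
  refine Integrable.mono' hb ?_ ?_
  · have := measurable_planckKernel
    apply Measurable.aestronglyMeasurable
    unfold Function.uncurry
    fun_prop
  · rw [Measure.prod_restrict]
    refine (ae_restrict_iff' (measurableSet_Ioi.prod measurableSet_Ioi)).mpr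
      (ae_of_all _ fun ⟨x, t⟩ ⟨hx, ht⟩ => ?_)
    simp only [mem_Ioi] at hx ht
    have h0 := planckKernel_pos hx
    simp only [Function.uncurry, norm_mul, Real.norm_eq_abs, pow_one]
    rw [abs_of_pos h0, abs_of_pos (Real.rpow_pos_of_pos ht _), abs_of_pos (Real.exp_pos _)]
    calc planckKernel x * (t ^ (s - 1) * Real.exp (-t) * |Real.sin (t * x)|)
        ≤ planckKernel x * (t ^ (s - 1) * Real.exp (-t) * (t * x)) := by
          gcongr
          exact Real.abs_sin_le_abs.trans_eq (abs_of_pos (by positivity))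
      _ = _ := by
          have : t ^ (s + 1 - 1) = t ^ (s - 1) * t := by
            rw [← Real.rpow_add_one ht.ne']; ring_nf
          rw [this]
          ring

/-- Hermite's formula for the Riemann zeta function, for real `s > 1`. -/
theorem hermite_formula {s : ℝ} (hs : 1 < s) :
    ((∫ x in Ioi (0 : ℝ), planckKernel x *
        (-2 * (Complex.exp (-s * Complex.log (1 + x * Complex.I))).im) : ℝ) : ℂ)
      = riemannZeta s - 1 / (s - 1) - 1 / 2 := by
  have hs0 : 0 < s := by linarith
  have hG : Real.Gamma s ≠ 0 := (Real.Gamma_pos_of_pos hs0).ne'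
  have hsw := integral_integral_swap (integrable_planckKernel_mul_gamma_sin hs0)
  simp only [integral_const_mul, integral_rpow_mul_exp_neg_mul_sin hs0] at hsw
  -- The inner integral is coth(t/2)/4 - 1/(2t); multiplying by e^{-t} and using e^{-t}/(e^t - 1) =
  -- 1/(e^t - 1) - e^{-t} separates one zeta integral and two Gamma integrals.
  have hinner : ∀ t ∈ Ioi (0 : ℝ), ∫ x in Ioi (0 : ℝ),
      planckKernel x * (t ^ (s - 1) * Real.exp (-t) * Real.sin (t * x))
      = 1 / 2 * (t ^ (s - 1) * (Real.exp t - 1)⁻¹) - 1 / 4 * (t ^ (s - 1) * Real.exp (-t))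
        - 1 / 2 * (t ^ (s - 1 - 1) * Real.exp (-t)) := by
    intro t (ht : 0 < t)
    have e : ∀ x, planckKernel x * (t ^ (s - 1) * Real.exp (-t) * Real.sin (t * x))
      = t ^ (s - 1) * Real.exp (-t) * (planckKernel x * Real.sin (t * x)) := fun x => by ring
    simp only [e, integral_const_mul, integral_planckKernel_mul_sin ht]
    have h1 : t ^ (s - 1) = t ^ (s - 1 - 1) * t := by
      rw [← Real.rpow_add_one ht.ne']; ring_nf
    have h2 : Real.exp t - 1 ≠ 0 := by
      have : 1 < Real.exp t := Real.one_lt_exp_iff.mpr ht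
      linarith
    rw [h1, Real.exp_neg]
    have h3 := (Real.exp_pos t).ne'
    have h4 : 1 - (Real.exp t)⁻¹ ≠ 0 := by
      have : 1 - (Real.exp t)⁻¹ = (Real.exp t - 1) / Real.exp t := by field_simp
      rw [this]
      exact div_ne_zero h2 h3
    field_simp
    ring
  rw [setIntegral_congr_fun measurableSet_Ioi hinner, integral_sub, integral_sub] at hsw
  rotate_left
  · exact (integrableOn_rpow_mul_inv_exp_sub_one hs).const_mul _
  · exact (integrableOn_rpow_mul_exp_neg hs0).const_mul _
  · exact ((integrableOn_rpow_mul_inv_exp_sub_one hs).const_mul _).sub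
      ((integrableOn_rpow_mul_exp_neg hs0).const_mul _)
  · exact (integrableOn_rpow_mul_exp_neg (by linarith)).const_mul _
  simp only [integral_const_mul] at hsw
  have hg : ∀ {a : ℝ}, 0 < a → ∫ t in Ioi (0 : ℝ), t ^ (a - 1) * Real.exp (-t) = Real.Gamma a :=
    fun ha => by rw [Real.Gamma_eq_integral ha]; simp only [mul_comm]
  rw [hg hs0, hg (show 0 < s - 1 by linarith)] at hsw
  -- This recurrence turns Γ(s-1) into the polar term 1/(s-1).
  have hrec := Real.Gamma_add_one (s := s - 1) (by linarith)
  rw [sub_add_cancel] at hrec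
  have hl : ∀ x : ℝ, planckKernel x *
      (Real.Gamma s * -(Complex.exp (-s * Complex.log (1 + x * Complex.I))).im)
      = Real.Gamma s / 2 *
        (planckKernel x * (-2 * (Complex.exp (-s * Complex.log (1 + x * Complex.I))).im)) :=
    fun x => by ring
  simp only [hl, integral_const_mul] at hsw
  have hswC := congrArg (fun r : ℝ => (r : ℂ)) hsw
  push_cast [integral_rpow_mul_inv_exp_sub_one hs] at hswC
  have hGC : (Real.Gamma s : ℂ) ≠ 0 := Complex.ofReal_ne_zero.mpr hG
  have hsC : (s : ℂ) - 1 ≠ 0 := by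
    rw [← Complex.ofReal_one, ← Complex.ofReal_sub]
    exact Complex.ofReal_ne_zero.mpr (by linarith)
  have hrecC : (Real.Gamma s : ℂ) = (s - 1) * Real.Gamma (s - 1) := by
    rw [hrec]; push_cast; ring
  have hq : (Real.Gamma (s - 1) : ℂ) = Real.Gamma s / (s - 1) := by
    rw [hrecC]; field_simp
  rw [hq] at hswC
  apply mul_left_cancel₀ hGC
  linear_combination 2 * hswC

/-! ### Pointwise bounds for the Jensen functions -/

/-- The logarithm on the vertical line `Re z = 1`. -/
noncomputable def logOneAddI (x : ℝ) : ℂ := Complex.log (1 + x * Complex.I)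

theorem norm_one_add_mul_I_sq (x : ℝ) : ‖1 + (x : ℂ) * Complex.I‖ ^ 2 = 1 + x ^ 2 := by
  rw [← Complex.normSq_eq_norm_sq, Complex.normSq_apply]
  simp
  ring

theorem measurable_logOneAddI : Measurable logOneAddI := by
  unfold logOneAddI; fun_prop

theorem hasDerivAt_logOneAddI (x : ℝ) :
    HasDerivAt logOneAddI (Complex.I / (1 + x * Complex.I)) x := by
  have h1 : HasDerivAt (fun x : ℝ => 1 + (x : ℂ) * Complex.I) ((1 : ℂ) * Complex.I) x :=
    ((Complex.ofRealCLM.hasDerivAt (x := x)).mul_const Complex.I).const_add 1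
  have h2 := h1.clog_real (one_add_mul_I_mem_slitPlane x)
  rw [one_mul] at h2
  exact h2

theorem one_le_norm_one_add_mul_I (x : ℝ) : 1 ≤ ‖1 + (x : ℂ) * Complex.I‖ := by
  have h := norm_one_add_mul_I_sq x
  nlinarith [norm_nonneg (1 + (x : ℂ) * Complex.I), sq_nonneg x]

/-- Mean value inequality: the derivative i/(1+ix) has norm at most 1. -/
theorem norm_logOneAddI_le {x : ℝ} (hx : 0 ≤ x) : ‖logOneAddI x‖ ≤ x := by
  have h := Convex.norm_image_sub_le_of_norm_hasDerivWithin_le (s := univ) (C := 1)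
    (fun x _ => (hasDerivAt_logOneAddI x).hasDerivWithinAt) (fun x _ => ?_) convex_univ
    (mem_univ 0) (mem_univ x)
  · have h0 : logOneAddI 0 = 0 := by simp [logOneAddI]
    rwa [h0, sub_zero, one_mul, sub_zero, Real.norm_of_nonneg hx] at h
  · rw [norm_div, Complex.norm_I]
    exact (div_le_one (by linarith [one_le_norm_one_add_mul_I x])).mpr
      (one_le_norm_one_add_mul_I x)

theorem logOneAddI_re (x : ℝ) : (logOneAddI x).re = Real.log (1 + x ^ 2) / 2 := by
  rw [logOneAddI, Complex.log_re, ← norm_one_add_mul_I_sq, Real.log_pow]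
  push_cast
  ring

theorem logOneAddI_im (x : ℝ) : (logOneAddI x).im = Real.arctan x := by
  rw [logOneAddI, Complex.log_im, Complex.arg_of_re_nonneg (by simp)]
  have h := norm_one_add_mul_I_sq x
  rw [Real.arctan_eq_arcsin, ← h, Real.sqrt_sq (norm_nonneg _)]
  simp

theorem exp_neg_logOneAddI (x : ℝ) :
    Complex.exp (-logOneAddI x) = (1 - x * Complex.I) / ((1 + x ^ 2 : ℝ) : ℂ) := by
  have hne := Complex.slitPlane_ne_zero (one_add_mul_I_mem_slitPlane x)
  have h2 : ((1 + x ^ 2 : ℝ) : ℂ) ≠ 0 := Complex.ofReal_ne_zero.mpr (by positivity)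
  rw [logOneAddI, Complex.exp_neg, Complex.exp_log hne, eq_div_iff h2,
    inv_mul_eq_iff_eq_mul₀ hne]
  push_cast
  linear_combination (x : ℂ) ^ 2 * Complex.I_sq

/-- The function whose integral against the Planck kernel is the `m`-th Stieltjes constant. -/
noncomputable def jensenFun (m : ℕ) (x : ℝ) : ℝ :=
  -2 * (logOneAddI x ^ m * Complex.exp (-logOneAddI x)).im

theorem jensenFun_eq (m : ℕ) (x : ℝ) :
    jensenFun m x
      = 2 * (x * (logOneAddI x ^ m).re - (logOneAddI x ^ m).im) / (1 + x ^ 2) := by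
  rw [jensenFun, exp_neg_logOneAddI, mul_div_assoc', Complex.div_ofReal_im, Complex.mul_im]
  simp
  ring

theorem measurable_jensenFun (m : ℕ) : Measurable (jensenFun m) := by
  have := measurable_logOneAddI
  unfold jensenFun
  fun_prop

/-- Strictness comes from the factor 1/|1+ix| < 1 for x > 0. -/
theorem abs_jensenFun_lt {x : ℝ} (hx : 0 < x) (m : ℕ) {A : ℝ}
    (h : ‖logOneAddI x ^ m * (1 - x * Complex.I)‖ ≤ A * Real.sqrt (1 + x ^ 2)) (hA : 0 < A) :
    |jensenFun m x| < 2 * A := by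
  have h1 : (1 : ℝ) < 1 + x ^ 2 := by nlinarith
  have h2 : Real.sqrt (1 + x ^ 2) < 1 + x ^ 2 := by
    rw [Real.sqrt_lt' (by linarith)]
    nlinarith
  rw [jensenFun, abs_mul, abs_neg, abs_two]
  gcongr
  refine (Complex.abs_im_le_norm _).trans_lt ?_
  rw [exp_neg_logOneAddI, mul_div_assoc', norm_div, Complex.norm_real,
    Real.norm_of_nonneg (by linarith), div_lt_iff₀ (by linarith)]
  exact h.trans_lt (by gcongr)

theorem norm_one_sub_mul_I (x : ℝ) : ‖1 - (x : ℂ) * Complex.I‖ = Real.sqrt (1 + x ^ 2) := by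
  have h := norm_one_add_mul_I_sq (-x)
  rw [neg_sq] at h
  rw [← h, Real.sqrt_sq (norm_nonneg _)]
  push_cast
  ring_nf

theorem abs_jensenFun_lt_pow {x : ℝ} (hx : 0 < x) (m : ℕ) : |jensenFun m x| < 2 * x ^ m := by
  refine abs_jensenFun_lt hx m ?_ (by positivity)
  rw [norm_mul, norm_pow, norm_one_sub_mul_I]
  gcongr
  exact norm_logOneAddI_le hx.le

/-- The imaginary part of an even power vanishes with Re z. For z = log(1+ix), Re z is of order x²,
so one power of `x` is gained over the trivial bound. -/
theorem abs_im_pow_two_mul_le (z : ℂ) (k : ℕ) :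
    |(z ^ (2 * k)).im| ≤ 2 * k * |z.re| * ‖z‖ ^ (2 * k - 1) := by
  induction k with
  | zero => simp
  | succ k ih =>
    have h1 : |(z ^ (2 * k)).re| ≤ ‖z‖ ^ (2 * k) := by
      rw [← norm_pow]; exact Complex.abs_re_le_norm _
    have h2 : |(z ^ 2).re| ≤ ‖z‖ ^ 2 := by rw [← norm_pow]; exact Complex.abs_re_le_norm _
    have h3 : |(z ^ 2).im| ≤ 2 * |z.re| * ‖z‖ := by
      have e : (z ^ 2).im = 2 * z.re * z.im := by rw [sq, Complex.mul_im]; ring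
      rw [e, abs_mul, abs_mul, abs_two]
      gcongr
      exact Complex.abs_im_le_norm z
    -- At k = 0 the truncated exponent 2k - 1 is harmless because of the factor 2k.
    have e1 : (2 * k * |z.re| * ‖z‖ ^ (2 * k - 1)) * ‖z‖ ^ 2 = 2 * k * |z.re| * ‖z‖ ^ (2 * k + 1) := by
      rcases Nat.eq_zero_or_pos k with rfl | hk
      · simp
      · rw [mul_assoc, ← pow_add]
        congr 2
        omega
    rw [mul_add, pow_add, mul_one, Complex.mul_im]
    calc |(z ^ (2 * k)).re * (z ^ 2).im + (z ^ (2 * k)).im * (z ^ 2).re|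
        ≤ |(z ^ (2 * k)).re| * |(z ^ 2).im| + |(z ^ (2 * k)).im| * |(z ^ 2).re| := by
          rw [← abs_mul, ← abs_mul]; exact abs_add_le _ _
      _ ≤ ‖z‖ ^ (2 * k) * (2 * |z.re| * ‖z‖)
          + (2 * k * |z.re| * ‖z‖ ^ (2 * k - 1)) * ‖z‖ ^ 2 := by gcongr
      _ = _ := by
        rw [e1, show 2 * k + 2 - 1 = 2 * k + 1 by omega]
        push_cast
        ring

theorem abs_logOneAddI_re_le (x : ℝ) : |(logOneAddI x).re| ≤ x ^ 2 / 2 := by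
  rw [logOneAddI_re, abs_of_nonneg (div_nonneg (Real.log_nonneg (by nlinarith [sq_nonneg x]))
    (by norm_num))]
  have := Real.log_le_sub_one_of_pos (show 0 < 1 + x ^ 2 by positivity)
  linarith

theorem abs_jensenFun_lt_of_even {x : ℝ} (hx : 0 < x) (k : ℕ) :
    |jensenFun (2 * k) x| < (2 * k + 2) * x ^ (2 * k + 1) := by
  have hL := norm_logOneAddI_le hx.le
  have h1 : |(logOneAddI x ^ (2 * k)).im| ≤ k * x ^ (2 * k + 1) := by
    refine (abs_im_pow_two_mul_le _ _).trans ?_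
    calc _ ≤ 2 * k * (x ^ 2 / 2) * x ^ (2 * k - 1) := by
          gcongr
          exact abs_logOneAddI_re_le x
      _ = _ := by
        rcases Nat.eq_zero_or_pos k with rfl | hk
        · simp
        · rw [show 2 * k + 1 = 2 + (2 * k - 1) by omega, pow_add]
          ring
  have h2 : |(logOneAddI x ^ (2 * k)).re| ≤ x ^ (2 * k) := by
    refine (Complex.abs_re_le_norm _).trans ?_
    rw [norm_pow]
    gcongr
  rw [jensenFun_eq, abs_div, abs_mul, abs_two, abs_of_pos (show 0 < 1 + x ^ 2 by positivity),
    div_lt_iff₀ (by positivity)]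
  calc 2 * |x * (logOneAddI x ^ (2 * k)).re - (logOneAddI x ^ (2 * k)).im|
      ≤ 2 * (|x| * |(logOneAddI x ^ (2 * k)).re| + |(logOneAddI x ^ (2 * k)).im|) := by
        rw [← abs_mul]
        gcongr
        exact abs_sub _ _
    _ ≤ 2 * (x * x ^ (2 * k) + k * x ^ (2 * k + 1)) := by
        rw [abs_of_pos hx]
        gcongr
    _ = (2 * k + 2) * x ^ (2 * k + 1) * 1 := by ring
    _ < _ := by
        gcongr
        nlinarith

theorem jensenFun_zero (x : ℝ) : jensenFun 0 x = 2 * x / (1 + x ^ 2) := by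
  rw [jensenFun_eq]; simp

/-- A majorant summable in `m` that keeps one factor `x` against the pole of the kernel. Truncated
subtraction makes it 2x for both m = 0 and m = 1, whence the extra 1 in
`hasSum_pow_div_factorial_pred`. -/
theorem abs_jensenFun_div_factorial_le {x : ℝ} (hx : 0 < x) (m : ℕ) :
    |jensenFun m x| / m.factorial ≤ 2 * x * (x ^ (m - 1) / (m - 1).factorial) := by
  cases m with
  | zero =>
    have := abs_jensenFun_lt_of_even hx 0
    simp at this ⊢
    linarith
  | succ m =>
    calc |jensenFun (m + 1) x| / (m + 1).factorial
        ≤ 2 * x ^ (m + 1) / m.factorial := by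
          gcongr
          · exact (abs_jensenFun_lt_pow hx _).le
          · omega
      _ = _ := by
        rw [Nat.add_sub_cancel]
        ring

/-! ### The integral representation of the Stieltjes constants -/

theorem integrableOn_planckKernel_mul_jensenFun (m : ℕ) :
    IntegrableOn (fun x => planckKernel x * jensenFun m x) (Ioi 0) := by
  have hm : ∃ j, j ≠ 0 ∧ ∃ c : ℝ, ∀ x, 0 < x → |jensenFun m x| ≤ c * x ^ j := by
    cases m with
    | zero => exact ⟨1, one_ne_zero, 2, fun x hx => by simpa using (abs_jensenFun_lt_of_even hx 0).le⟩
    | succ m => exact ⟨m + 1, by omega, 2, fun x hx => (abs_jensenFun_lt_pow hx _).le⟩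
  obtain ⟨j, hj, c, hc⟩ := hm
  refine Integrable.mono' ((integrableOn_planckKernel_mul_pow hj).const_mul c)
    (measurable_planckKernel.mul (measurable_jensenFun m)).aestronglyMeasurable ?_
  refine (ae_restrict_iff' measurableSet_Ioi).mpr (ae_of_all _ fun x (hx : 0 < x) => ?_)
  have h0 := planckKernel_pos hx
  rw [norm_mul, Real.norm_of_nonneg h0.le, Real.norm_eq_abs]
  calc _ ≤ planckKernel x * (c * x ^ j) := by gcongr; exact hc x hx
    _ = _ := by ring

theorem hasSum_jensenFun (x y : ℝ) :
    HasSum (fun m : ℕ => (-1) ^ m / (m.factorial : ℝ) * jensenFun m x * y ^ m)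
      (-2 * (Complex.exp (-((1 + y : ℝ) : ℂ) * logOneAddI x)).im) := by
  have h := NormedSpace.expSeries_div_hasSum_exp (𝔸 := ℂ) (-(y : ℂ) * logOneAddI x)
  rw [← Complex.exp_eq_exp_ℂ] at h
  have h2 := ((h.mul_right (Complex.exp (-logOneAddI x))).mapL Complex.imCLM).mul_left (-2 : ℝ)
  convert! h2 using 1
  · funext m
    have e : (-(y : ℂ) * logOneAddI x) ^ m / (m.factorial : ℂ) * Complex.exp (-logOneAddI x)
        = (((-1) ^ m / (m.factorial : ℝ) * y ^ m : ℝ) : ℂ)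
          * (logOneAddI x ^ m * Complex.exp (-logOneAddI x)) := by
      push_cast
      rw [mul_pow, neg_pow]
      ring
    simp only [Complex.imCLM_apply]
    rw [e, Complex.im_ofReal_mul, jensenFun]
    ring
  · rw [← Complex.exp_add]
    simp only [Complex.imCLM_apply]
    congr 3
    push_cast
    ring

theorem hasSum_pow_div_factorial_pred (x : ℝ) :
    HasSum (fun m : ℕ => x ^ (m - 1) / ((m - 1).factorial : ℝ)) (1 + Real.exp x) := by
  have h := NormedSpace.expSeries_div_hasSum_exp (𝔸 := ℝ) x
  rw [← Real.exp_eq_exp_ℝ] at h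
  have h1 := (hasSum_nat_add_iff (f := fun m : ℕ => x ^ (m - 1) / ((m - 1).factorial : ℝ)) 1).mp
    (by simpa using h)
  simpa [add_comm] using h1

/-- The integral against the Planck kernel, integrated term by term. -/
theorem hasSum_integral_planckKernel_mul_jensenFun {y : ℝ} (hy : 0 < y) (hy1 : y < 1) :
    HasSum (fun m : ℕ => (-1) ^ m / (m.factorial : ℝ) *
        (∫ x in Ioi (0 : ℝ), planckKernel x * jensenFun m x) * y ^ m)
      (∫ x in Ioi (0 : ℝ), planckKernel x *
        (-2 * (Complex.exp (-((1 + y : ℝ) : ℂ) * logOneAddI x)).im)) := by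
  have hS := hasSum_integral_of_dominated_convergence (μ := volume.restrict (Ioi (0 : ℝ)))
    (F := fun (m : ℕ) x => planckKernel x *
      ((-1) ^ m / (m.factorial : ℝ) * jensenFun m x * y ^ m))
    (f := fun x => planckKernel x *
      (-2 * (Complex.exp (-((1 + y : ℝ) : ℂ) * logOneAddI x)).im))
    (fun m x => 2 * (planckKernel x * x) * (x ^ (m - 1) / (m - 1).factorial))
    (fun m => (measurable_planckKernel.mul
      (((measurable_jensenFun m).const_mul _).mul_const _)).aestronglyMeasurable)
    (fun m => (ae_restrict_iff' measurableSet_Ioi).mpr (ae_of_all _ fun x (hx : 0 < x) => ?_))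
    (ae_of_all _ fun x => ((hasSum_pow_div_factorial_pred x).mul_left _).summable)
    ?_
    (ae_of_all _ fun x => (hasSum_jensenFun x y).mul_left _)
  · convert! hS using 1
    funext m
    rw [← integral_const_mul, ← integral_mul_const]
    congr 1
    funext x
    ring
  · have h0 := planckKernel_pos hx
    have h1 := abs_jensenFun_div_factorial_le hx m
    have h2 : y ^ m ≤ 1 := pow_le_one₀ hy.le hy1.le
    rw [norm_mul, Real.norm_of_nonneg h0.le, Real.norm_eq_abs, abs_mul, abs_mul, abs_div, abs_pow,
      abs_neg, abs_one, one_pow, abs_of_pos (pow_pos hy m), Nat.abs_cast]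
    calc planckKernel x * (1 / m.factorial * |jensenFun m x| * y ^ m)
        ≤ planckKernel x * (1 / m.factorial * |jensenFun m x| * 1) := by gcongr
      _ = planckKernel x * (|jensenFun m x| / m.factorial) := by ring
      _ ≤ planckKernel x * (2 * x * (x ^ (m - 1) / (m - 1).factorial)) := by gcongr
      _ = _ := by ring
  · simp only [fun x : ℝ => ((hasSum_pow_div_factorial_pred x).mul_left
      (2 * (planckKernel x * x))).tsum_eq]
    refine Integrable.mono' ((exp_neg_integrableOn_Ioi 0 one_pos).const_mul 4)
      (((measurable_planckKernel.mul measurable_id).const_mul 2).mul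
        (by fun_prop)).aestronglyMeasurable ?_
    refine (ae_restrict_iff' measurableSet_Ioi).mpr (ae_of_all _ fun x (hx : 0 < x) => ?_)
    have h0 := planckKernel_pos hx
    have h1 := planckKernel_mul_le hx
    -- Since π > 2, one factor e^{-x} absorbs the e^x from the summed majorant and another remains
    -- for integrability.
    have h2 : Real.exp (-Real.pi * x) ≤ Real.exp (-1 * x) * Real.exp (-x) := by
      rw [← Real.exp_add]
      gcongr
      nlinarith [Real.pi_gt_three]
    have h3 : 1 ≤ Real.exp x := Real.one_le_exp hx.le
    have h4 : Real.exp (-x) * Real.exp x = 1 := by rw [← Real.exp_add]; simp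
    rw [Real.norm_of_nonneg (by positivity)]
    calc 2 * (planckKernel x * x) * (1 + Real.exp x)
        ≤ 2 * (Real.exp (-1 * x) * Real.exp (-x)) * (Real.exp x + Real.exp x) := by
          have := h1.trans h2
          gcongr (2 * ?_) * (?_ + _)
      _ = 4 * Real.exp (-1 * x) * (Real.exp (-x) * Real.exp x) := by ring
      _ = _ := by rw [h4, mul_one]

/-- Uniqueness of coefficients from one side only, as Hermite's formula is available for y > 0. Once
the coefficients below `n` vanish, divide by y^n and let y → 0+, dominating by the series at y =
1/2. -/
theorem eq_zero_of_hasSum_mul_pow_eq_zero {c : ℕ → ℝ}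
    (hc : ∀ y : ℝ, 0 < y → y < 1 → HasSum (fun m => c m * y ^ m) 0) (n : ℕ) : c n = 0 := by
  induction n using Nat.strong_induction_on with
  | _ n ih =>
    have hs : ∀ y : ℝ, 0 < y → y < 1 → HasSum (fun i => c (i + n) * y ^ i) 0 := by
      intro y hy hy1
      have h := (hasSum_nat_add_iff' n).mpr (hc y hy hy1)
      rw [Finset.sum_eq_zero fun i hi => by rw [ih i (Finset.mem_range.mp hi), zero_mul],
        sub_zero] at h
      have h2 := h.mul_right ((y ^ n)⁻¹)
      rw [zero_mul] at h2
      convert! h2 using 1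
      funext i
      have := (pow_pos hy n).ne'
      rw [pow_add]
      field_simp
    have ht : Tendsto (fun y : ℝ => ∑' i, c (i + n) * y ^ i) (𝓝[>] 0)
        (𝓝 (∑' i, c (i + n) * (0 : ℝ) ^ i)) := by
      refine tendsto_tsum_of_dominated_convergence
        (bound := fun i => |c (i + n) * (1 / 2 : ℝ) ^ i|)
        (hs (1 / 2) (by norm_num) (by norm_num)).summable.abs (fun i => ?_) ?_
      · refine Tendsto.mono_left ?_ nhdsWithin_le_nhds
        exact (Continuous.tendsto (by fun_prop) 0)
      · filter_upwards [Ioo_mem_nhdsGT (show (0 : ℝ) < 1 / 2 by norm_num)] with y hy i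
        rw [Real.norm_eq_abs, abs_mul, abs_mul, abs_of_pos (pow_pos hy.1 i),
          abs_of_pos (by positivity : (0 : ℝ) < (1 / 2) ^ i)]
        gcongr
        · exact hy.1.le
        · exact hy.2.le
    have h0 : Tendsto (fun y : ℝ => ∑' i, c (i + n) * y ^ i) (𝓝[>] 0) (𝓝 0) := by
      refine tendsto_const_nhds.congr' ?_
      filter_upwards [Ioo_mem_nhdsGT (show (0 : ℝ) < 1 by norm_num)] with y hy
      exact (hs y hy.1 hy.2).tsum_eq.symm
    have := tendsto_nhds_unique ht h0
    rw [tsum_eq_single 0 (fun i hi => by simp [hi])] at this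
    simpa using this

/-- The integral representation of the Stieltjes constants of Jensen and Franel. -/
theorem stieltjesConstant_eq_integral (m : ℕ) :
    stieltjesConstant m - (if m = 0 then 1 / 2 else 0)
      = ∫ x in Ioi (0 : ℝ), planckKernel x * jensenFun m x := by
  set A : ℕ → ℝ := fun m => ∫ x in Ioi (0 : ℝ), planckKernel x * jensenFun m x with hA
  have key := eq_zero_of_hasSum_mul_pow_eq_zero (c := fun m => (-1) ^ m / (m.factorial : ℝ) *
    (stieltjesConstant m - (if m = 0 then 1 / 2 else 0) - A m)) (fun y hy hy1 => ?_) m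
  · have h1 : ((-1 : ℝ) ^ m / (m.factorial : ℝ)) ≠ 0 := by positivity
    have := (mul_eq_zero.mp key).resolve_left h1
    linarith
  · have hs1 : ((1 + y : ℝ) : ℂ) ≠ 1 := by
      rw [← Complex.ofReal_one]
      exact fun h => hy.ne' (by linarith [Complex.ofReal_injective h])
    have h1 := hasSum_stieltjesConstant hs1
    have h2 := (hasSum_integral_planckKernel_mul_jensenFun hy hy1).mapL Complex.ofRealCLM
    have hH := hermite_formula (s := 1 + y) (by linarith)
    -- The constant 1/2 in Hermite's formula affects only the coefficient of y^0, hence the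
    -- correction at m = 0.
    have h3 : HasSum (fun m : ℕ => if m = 0 then (1 / 2 : ℂ) else 0) (1 / 2) :=
      hasSum_ite_eq 0 _
    have h4 := (h1.sub h3).sub h2
    simp only [Complex.ofRealCLM_apply, logOneAddI] at h4
    rw [hH, sub_right_comm, sub_sub_cancel, sub_self] at h4
    rw [← Complex.hasSum_ofReal, Complex.ofReal_zero]
    convert! h4 using 1
    funext m
    rcases Nat.eq_zero_or_pos m with rfl | hm
    · simp [hA]
    · simp only [if_neg hm.ne', hA]
      push_cast
      ring

/-! ### From pointwise bounds to bounds for the Stieltjes constants -/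

theorem integral_planckKernel_mul_lt {f g : ℝ → ℝ}
    (hf : IntegrableOn (fun x => planckKernel x * f x) (Ioi 0))
    (hg : IntegrableOn (fun x => planckKernel x * g x) (Ioi 0)) (h : ∀ x, 0 < x → f x < g x) :
    ∫ x in Ioi (0 : ℝ), planckKernel x * f x < ∫ x in Ioi (0 : ℝ), planckKernel x * g x := by
  rw [← sub_pos, ← integral_sub hg hf]
  have hpos : ∀ x : ℝ, 0 < x → 0 < planckKernel x * g x - planckKernel x * f x := fun x hx => by
    rw [← mul_sub]
    exact mul_pos (planckKernel_pos hx) (sub_pos.mpr (h x hx))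
  rw [setIntegral_pos_iff_support_of_nonneg_ae ((ae_restrict_iff' measurableSet_Ioi).mpr
    (ae_of_all _ fun x hx => (hpos x hx).le)) (hg.sub hf)]
  have : Ioi (0 : ℝ) ⊆
      (Function.support fun x => planckKernel x * g x - planckKernel x * f x) ∩ Ioi 0 :=
    fun x hx => ⟨(hpos x hx).ne', hx⟩
  exact lt_of_lt_of_le (by simp) (measure_mono this)

theorem integrableOn_planckKernel_mul_const_mul_pow (c : ℝ) {j : ℕ} (hj : j ≠ 0) :
    IntegrableOn (fun x => planckKernel x * (c * x ^ j)) (Ioi 0) := by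
  simp only [mul_left_comm _ c]
  exact (integrableOn_planckKernel_mul_pow hj).const_mul c

theorem integral_planckKernel_mul_const_mul_pow (c : ℝ) (k : ℕ) :
    ∫ x in Ioi (0 : ℝ), planckKernel x * (c * x ^ (2 * k + 1))
      = c * (|(bernoulli (2 * (k + 1)) : ℝ)| / (4 * (k + 1))) := by
  simp only [mul_left_comm _ c, integral_const_mul]
  have h := integral_planckKernel_mul_pow (k + 1) (by omega)
  rw [show 2 * (k + 1) - 1 = 2 * k + 1 by omega] at h
  rw [h]
  push_cast
  rfl

theorem abs_integral_planckKernel_mul_jensenFun_lt {m k : ℕ} {c : ℝ}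
    (h : ∀ x, 0 < x → |jensenFun m x| < c * x ^ (2 * k + 1)) :
    |∫ x in Ioi (0 : ℝ), planckKernel x * jensenFun m x|
      < c * (|(bernoulli (2 * (k + 1)) : ℝ)| / (4 * (k + 1))) := by
  have hi := integrableOn_planckKernel_mul_jensenFun m
  rw [abs_lt, ← integral_planckKernel_mul_const_mul_pow]
  constructor
  · have e : -∫ x in Ioi (0 : ℝ), planckKernel x * (c * x ^ (2 * k + 1))
        = ∫ x in Ioi (0 : ℝ), planckKernel x * (-c * x ^ (2 * k + 1)) := by
      rw [← integral_neg]; congr 1; funext x; ring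
    rw [e]
    refine integral_planckKernel_mul_lt (integrableOn_planckKernel_mul_const_mul_pow _ (by omega))
      hi fun x hx => ?_
    have := (abs_lt.mp (h x hx)).1
    linarith
  · exact integral_planckKernel_mul_lt hi
      (integrableOn_planckKernel_mul_const_mul_pow _ (by omega)) fun x hx => (abs_lt.mp (h x hx)).2

theorem abs_stieltjesConstant_odd_lt (k : ℕ) :
    |stieltjesConstant (2 * k + 1)| < |(bernoulli (2 * (k + 1)) : ℝ)| / (2 * k + 2) := by
  have h := stieltjesConstant_eq_integral (2 * k + 1)
  rw [if_neg (by omega), sub_zero] at h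
  rw [h]
  refine (abs_integral_planckKernel_mul_jensenFun_lt (k := k) (c := 2)
    fun x hx => abs_jensenFun_lt_pow hx _).trans_eq ?_
  field_simp
  ring

theorem abs_stieltjesConstant_even_lt (k : ℕ) :
    |stieltjesConstant (2 * k) - (if 2 * k = 0 then 1 / 2 else 0)|
      < |(bernoulli (2 * (k + 1)) : ℝ)| / 2 := by
  rw [stieltjesConstant_eq_integral]
  refine (abs_integral_planckKernel_mul_jensenFun_lt (k := k) (c := 2 * k + 2)
    fun x hx => abs_jensenFun_lt_of_even hx k).trans_eq ?_
  field_simp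
  ring

theorem integrableOn_planckKernel_mul_two_pow (a b : ℝ) {i j : ℕ} (hi : i ≠ 0) (hj : j ≠ 0) :
    IntegrableOn (fun x => planckKernel x * (a * x ^ i + b * x ^ j)) (Ioi 0) := by
  simp only [mul_add]
  exact (integrableOn_planckKernel_mul_const_mul_pow a hi).add
    (integrableOn_planckKernel_mul_const_mul_pow b hj)

theorem integral_planckKernel_mul_two_pow (a b : ℝ) (k l : ℕ) :
    ∫ x in Ioi (0 : ℝ), planckKernel x * (a * x ^ (2 * k + 1) + b * x ^ (2 * l + 1))
      = a * (|(bernoulli (2 * (k + 1)) : ℝ)| / (4 * (k + 1)))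
        + b * (|(bernoulli (2 * (l + 1)) : ℝ)| / (4 * (l + 1))) := by
  simp only [mul_add (planckKernel _)]
  rw [integral_add (integrableOn_planckKernel_mul_const_mul_pow a (by omega))
    (integrableOn_planckKernel_mul_const_mul_pow b (by omega)),
    integral_planckKernel_mul_const_mul_pow, integral_planckKernel_mul_const_mul_pow]

theorem stieltjesConstant_lt_of_jensenFun_lt {m k l : ℕ} {a b : ℝ}
    (h : ∀ x, 0 < x → jensenFun m x < a * x ^ (2 * k + 1) + b * x ^ (2 * l + 1)) :
    stieltjesConstant m - (if m = 0 then 1 / 2 else 0)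
      < a * (|(bernoulli (2 * (k + 1)) : ℝ)| / (4 * (k + 1)))
        + b * (|(bernoulli (2 * (l + 1)) : ℝ)| / (4 * (l + 1))) := by
  rw [stieltjesConstant_eq_integral, ← integral_planckKernel_mul_two_pow]
  exact integral_planckKernel_mul_lt (integrableOn_planckKernel_mul_jensenFun m)
    (integrableOn_planckKernel_mul_two_pow a b (by omega) (by omega)) h

theorem lt_stieltjesConstant_of_lt_jensenFun {m k l : ℕ} {a b : ℝ}
    (h : ∀ x, 0 < x → a * x ^ (2 * k + 1) + b * x ^ (2 * l + 1) < jensenFun m x) :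
    a * (|(bernoulli (2 * (k + 1)) : ℝ)| / (4 * (k + 1)))
        + b * (|(bernoulli (2 * (l + 1)) : ℝ)| / (4 * (l + 1)))
      < stieltjesConstant m - (if m = 0 then 1 / 2 else 0) := by
  rw [stieltjesConstant_eq_integral, ← integral_planckKernel_mul_two_pow]
  exact integral_planckKernel_mul_lt
    (integrableOn_planckKernel_mul_two_pow a b (by omega) (by omega))
    (integrableOn_planckKernel_mul_jensenFun m) h

/-! ### Two-term Taylor bounds for m = 0, 1, 2 -/

theorem sub_cube_div_three_le_arctan {x : ℝ} (hx : 0 ≤ x) : x - x ^ 3 / 3 ≤ Real.arctan x := by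
  have hd : ∀ y : ℝ, HasDerivAt (fun y : ℝ => Real.arctan y - (y - y ^ 3 / 3))
      (1 / (1 + y ^ 2) - (1 - 3 * y ^ 2 / 3)) y := fun y =>
    (Real.hasDerivAt_arctan y).sub
      ((hasDerivAt_id y).sub (by simpa using (hasDerivAt_pow 3 y).div_const 3))
  have hm : Monotone (fun y : ℝ => Real.arctan y - (y - y ^ 3 / 3)) := by
    refine monotone_of_deriv_nonneg (fun y => (hd y).differentiableAt) fun y => ?_
    rw [(hd y).deriv]
    have h1 : 0 < 1 + y ^ 2 := by positivity
    have : 1 / (1 + y ^ 2) - (1 - 3 * y ^ 2 / 3) = y ^ 4 / (1 + y ^ 2) := by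
      field_simp
      ring
    rw [this]
    positivity
  have := hm hx
  simp only [Real.arctan_zero] at this
  linarith

theorem sub_sq_div_two_le_log_one_add {u : ℝ} (hu : 0 ≤ u) : u - u ^ 2 / 2 ≤ Real.log (1 + u) := by
  refine le_trans ?_ (Real.le_log_one_add_of_nonneg hu)
  rw [le_div_iff₀ (by linarith)]
  nlinarith [pow_nonneg hu 3]

theorem log_one_add_sq_le (x : ℝ) : Real.log (1 + x ^ 2) ≤ x ^ 2 := by
  have := Real.log_le_sub_one_of_pos (show 0 < 1 + x ^ 2 by positivity)
  linarith

theorem lt_jensenFun_zero {x : ℝ} (hx : 0 < x) : 2 * x - 2 * x ^ 3 < jensenFun 0 x := by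
  rw [jensenFun_zero, lt_div_iff₀ (by positivity)]
  nlinarith [pow_pos hx 5]

theorem jensenFun_one_lt {x : ℝ} (hx : 0 < x) :
    jensenFun 1 x < -2 * x + 11 / 3 * x ^ 3 := by
  rw [jensenFun_eq, pow_one, logOneAddI_re, logOneAddI_im, div_lt_iff₀ (by positivity)]
  have h1 := mul_le_mul_of_nonneg_left (log_one_add_sq_le x) hx.le
  have h2 := sub_cube_div_three_le_arctan hx.le
  nlinarith [pow_pos hx 5]

theorem jensenFun_two_lt {x : ℝ} (hx : 0 < x) :
    jensenFun 2 x < -4 * x ^ 3 + 15 / 2 * x ^ 5 := by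
  rw [jensenFun_eq, sq, Complex.mul_re, Complex.mul_im, logOneAddI_re, logOneAddI_im,
    div_lt_iff₀ (by positivity)]
  set a := Real.log (1 + x ^ 2) / 2 with ha
  set b := Real.arctan x with hb
  have ha0 : 0 ≤ a := div_nonneg (Real.log_nonneg (by nlinarith)) (by norm_num)
  have hb0 : 0 ≤ b := Real.arctan_nonneg.mpr hx.le
  have ha1 : a ≤ x ^ 2 / 2 := by have := log_one_add_sq_le x; rw [ha]; linarith
  have ha2 : x * (a * a) ≤ x * (x ^ 2 / 2 * (x ^ 2 / 2)) := by gcongr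
  -- For x ≤ 1 the Taylor lower bounds of `a` and `b` are nonnegative and can be multiplied; for x >
  -- 1 the signs of `a` and `b` suffice, as the x^7 term dominates.
  rcases le_or_gt x 1 with hx1 | hx1
  · have hx2 : x ^ 2 ≤ 1 := pow_le_one₀ hx.le hx1
    have hb1 : x - x ^ 3 / 3 ≤ b := sub_cube_div_three_le_arctan hx.le
    have hb1' : 0 ≤ x - x ^ 3 / 3 := by nlinarith
    have ha3 : x ^ 2 / 2 - x ^ 4 / 4 ≤ a := by
      have := sub_sq_div_two_le_log_one_add (sq_nonneg x)
      rw [ha]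
      nlinarith
    have ha3' : 0 ≤ x ^ 2 / 2 - x ^ 4 / 4 := by nlinarith [sq_nonneg x]
    have h1 : (x ^ 2 / 2 - x ^ 4 / 4) * (x - x ^ 3 / 3) ≤ a * b := by gcongr
    have h2 : x * ((x - x ^ 3 / 3) * (x - x ^ 3 / 3)) ≤ x * (b * b) := by gcongr
    nlinarith [pow_pos hx 7]
  · have h1 : 0 ≤ x * (b * b) := by positivity
    have h2 : 0 ≤ a * b := by positivity
    have h3 : 0 < x ^ 3 * (x ^ 2 - 1) := mul_pos (by positivity) (by nlinarith)
    have h4 : 0 < x ^ 5 * (x ^ 2 - 1) := mul_pos (by positivity) (by nlinarith)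
    nlinarith [pow_pos hx 7, pow_pos hx 5, pow_pos hx 3]

/-! ### Growth of the Bernoulli numbers -/

theorem one_le_tsum_one_div_pow (k : ℕ) (hk : k ≠ 0) :
    1 ≤ ∑' n : ℕ, 1 / (n : ℝ) ^ (2 * k) := by
  have := (hasSum_zeta_nat hk).summable.le_tsum 1 (fun n _ => by positivity)
  simpa using this

theorem tsum_one_div_pow_le (k : ℕ) (hk : k ≠ 0) :
    ∑' n : ℕ, 1 / (n : ℝ) ^ (2 * k) ≤ Real.pi ^ 2 / 6 := by
  rw [← hasSum_zeta_two.tsum_eq]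
  refine Summable.tsum_le_tsum (fun n => ?_) (hasSum_zeta_nat hk).summable hasSum_zeta_two.summable
  rcases Nat.eq_zero_or_pos n with rfl | hn
  · simp [hk]
  · have : (1 : ℝ) ≤ n := by exact_mod_cast hn
    gcongr
    · omega

theorem abs_bernoulli_pos (k : ℕ) (hk : k ≠ 0) : 0 < |(bernoulli (2 * k) : ℝ)| := by
  have h := (abs_bernoulli_two_mul k hk).2
  have h1 := one_le_tsum_one_div_pow k hk
  refine (abs_nonneg _).lt_of_ne fun h0 => ?_
  rw [← h0, zero_mul] at h
  linarith

/-- Euler's formula with ζ(2k+2) ≥ 1 and ζ(2k) ≤ π²/6 gives the factor 3/(2π⁴), of which 1539/100000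
is the value rounded down. -/
theorem bernoulli_ratio_le (k : ℕ) (hk : k ≠ 0) :
    1539 / 100000 * ((2 * k + 2) * (2 * k + 1)) * |(bernoulli (2 * k) : ℝ)|
      ≤ |(bernoulli (2 * (k + 1)) : ℝ)| := by
  have hpi := Real.pi_pos
  have h1 := (abs_bernoulli_two_mul k hk).2.trans_le (tsum_one_div_pow_le k hk)
  have h2 := (one_le_tsum_one_div_pow (k + 1) (by omega)).trans_eq
    (abs_bernoulli_two_mul (k + 1) (by omega)).2.symm
  have hf : ((2 * (k + 1)).factorial : ℝ) = (2 * k + 2) * ((2 * k + 1) * (2 * k).factorial) := by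
    rw [show 2 * (k + 1) = 2 * k + 1 + 1 by ring, Nat.factorial_succ, Nat.factorial_succ]
    push_cast
    ring
  have h2p : (2 : ℝ) ^ (2 * (k + 1) - 1) = 4 * 2 ^ (2 * k - 1) := by
    rw [show 2 * (k + 1) - 1 = 2 + (2 * k - 1) by omega, pow_add]; norm_num
  have hpp : Real.pi ^ (2 * (k + 1)) = Real.pi ^ 2 * Real.pi ^ (2 * k) := by
    rw [← pow_add]; congr 1; ring
  rw [hf, h2p, hpp] at h2
  set C : ℝ := 2 ^ (2 * k - 1) * Real.pi ^ (2 * k) / (2 * k).factorial with hC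
  have hC0 : 0 < C := by positivity
  have e : 4 * 2 ^ (2 * k - 1) * (Real.pi ^ 2 * Real.pi ^ (2 * k))
      / ((2 * k + 2) * ((2 * k + 1) * (2 * k).factorial))
      = C * (4 * Real.pi ^ 2 / ((2 * k + 2) * (2 * k + 1))) := by
    rw [hC]
    field_simp
  rw [e] at h2
  have hp4 : Real.pi ^ 4 ≤ 97.4102 := by
    calc Real.pi ^ 4 ≤ 3.1416 ^ 4 := by gcongr; exact Real.pi_lt_d4.le
      _ ≤ _ := by norm_num
  have hD : (0 : ℝ) < (2 * k + 2) * (2 * k + 1) := by positivity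
  have h3 : (2 * k + 2) * (2 * k + 1)
      ≤ |(bernoulli (2 * (k + 1)) : ℝ)| * C * (4 * Real.pi ^ 2) := by
    have := mul_le_mul_of_nonneg_right h2 hD.le
    rw [one_mul] at this
    refine this.trans_eq ?_
    field_simp
  refine le_of_mul_le_mul_right ?_ (mul_pos hC0 (show 0 < 4 * Real.pi ^ 2 by positivity))
  calc _ = 1539 / 100000 * ((2 * k + 2) * (2 * k + 1)) * (4 * Real.pi ^ 2)
        * (|(bernoulli (2 * k) : ℝ)| * C) := by ring
    _ ≤ 1539 / 100000 * ((2 * k + 2) * (2 * k + 1)) * (4 * Real.pi ^ 2) * (Real.pi ^ 2 / 6) := by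
      gcongr
    _ = ((2 * k + 2) * (2 * k + 1)) * (1539 / 100000 * 4 / 6 * Real.pi ^ 4) := by ring
    _ ≤ ((2 * k + 2) * (2 * k + 1)) * 1 := by
      gcongr
      linarith
    _ ≤ _ := by linarith

theorem bernoulli_four_eq : bernoulli 4 = -1 / 30 := by
  rw [bernoulli_eq_bernoulli'_of_ne_one (by norm_num), bernoulli'_four]

theorem bernoulli_six_eq : bernoulli 6 = 1 / 42 := by
  have h5 : bernoulli' 5 = 0 := bernoulli'_eq_zero_of_odd (by decide) (by norm_num)
  rw [bernoulli_eq_bernoulli'_of_ne_one (by norm_num), bernoulli'_def]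
  norm_num [Finset.sum_range_succ, h5, Nat.choose]

theorem two_mul_first_term_le_odd (k : ℕ) (hk : k ≠ 0) :
    2 * (|(bernoulli (2 * (k + 1)) : ℝ)| / (2 * k + 2))
      ≤ (6 * k + 11) * |(bernoulli (2 * (k + 2)) : ℝ)| / 24 := by
  obtain ⟨j, rfl⟩ := Nat.exists_eq_succ_of_ne_zero hk
  rcases Nat.eq_zero_or_pos j with rfl | hj
  -- For m = 3 the ratio estimate is too weak; the exact values give 1/60 ≤ 17/1008.
  · norm_num [bernoulli_four_eq, bernoulli_six_eq, abs_of_pos, abs_of_neg]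
  · have h := bernoulli_ratio_le (j + 1 + 1) (by omega)
    have hB := abs_nonneg ((bernoulli (2 * (j + 1 + 1)) : ℝ))
    have hj1 : (1 : ℝ) ≤ j := by exact_mod_cast hj
    simp only [Nat.succ_eq_add_one]
    push_cast at h ⊢
    refine le_trans ?_ (show (6 * ((j : ℝ) + 1) + 11) * (1539 / 100000 * ((2 * (j + 1 + 1) + 2)
      * (2 * (j + 1 + 1) + 1)) * |(bernoulli (2 * (j + 1 + 1)) : ℝ)|) / 24 ≤ _ by gcongr)
    rw [← sub_nonneg]
    have e : (6 * ((j : ℝ) + 1) + 11) * (1539 / 100000 * ((2 * (j + 1 + 1) + 2)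
        * (2 * (j + 1 + 1) + 1)) * |(bernoulli (2 * (j + 1 + 1)) : ℝ)|) / 24
        - 2 * (|(bernoulli (2 * (j + 1 + 1)) : ℝ)| / (2 * (j + 1) + 2))
        = |(bernoulli (2 * (j + 1 + 1)) : ℝ)| * ((6 * ((j : ℝ) + 1) + 11) *
          (1539 / 100000 * ((2 * (j + 1 + 1) + 2) * (2 * (j + 1 + 1) + 1))) / 24 - 1 / (j + 2)) := by
      field_simp
      ring
    rw [e]
    refine mul_nonneg hB (sub_nonneg.mpr ?_)
    calc 1 / ((j : ℝ) + 2) ≤ 1 / (1 + 2) := by gcongr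
      _ ≤ (6 * ((1 : ℝ) + 1) + 11) *
          (1539 / 100000 * ((2 * (1 + 1 + 1) + 2) * (2 * (1 + 1 + 1) + 1))) / 24 := by norm_num
      _ ≤ _ := by gcongr

/-- At k = 2 the coefficient supplied by `bernoulli_ratio_le` is about 1.005, just above the
required 1, and it increases with `k`. -/
theorem two_mul_first_term_le_even (k : ℕ) (hk : 2 ≤ k) :
    2 * (|(bernoulli (2 * (k + 1)) : ℝ)| / 2)
      ≤ (2 * k + 3) * (2 * k + 4) * |(bernoulli (2 * (k + 2)) : ℝ)| / 48 := by
  have h := bernoulli_ratio_le (k + 1) (by omega)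
  have hB := abs_nonneg ((bernoulli (2 * (k + 1)) : ℝ))
  have hk2 : (2 : ℝ) ≤ k := by exact_mod_cast hk
  push_cast at h
  calc 2 * (|(bernoulli (2 * (k + 1)) : ℝ)| / 2)
      = 1 * |(bernoulli (2 * (k + 1)) : ℝ)| := by ring
    _ ≤ ((2 * 2 + 3) * (2 * 2 + 4) * (1539 / 100000 * ((2 * (2 + 1) + 2)
        * (2 * (2 + 1) + 1))) / 48) * |(bernoulli (2 * (k + 1)) : ℝ)| := by gcongr; norm_num
    _ ≤ ((2 * k + 3) * (2 * k + 4) * (1539 / 100000 * ((2 * (k + 1) + 2)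
        * (2 * (k + 1) + 1))) / 48) * |(bernoulli (2 * (k + 1)) : ℝ)| := by gcongr
    _ = (2 * k + 3) * (2 * k + 4) * (1539 / 100000 * ((2 * (k + 1) + 2)
        * (2 * (k + 1) + 1)) * |(bernoulli (2 * (k + 1)) : ℝ)|) / 48 := by ring
    _ ≤ _ := by gcongr

/-! ### Stirling numbers and the first two nonvanishing terms -/

theorem stirlingFirst_add_two (m : ℕ) :
    (Nat.stirlingFirst (m + 2) (m + 1) : ℚ) = ((m : ℚ) + 1) * (m + 2) / 2 := by
  induction m with
  | zero => norm_num [Nat.stirlingFirst]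
  | succ m ih =>
    rw [show m + 1 + 2 = (m + 2) + 1 by ring, Nat.stirlingFirst_succ_succ, Nat.stirlingFirst_self]
    push_cast
    rw [ih]
    ring

theorem stirlingFirst_add_three (m : ℕ) :
    (Nat.stirlingFirst (m + 3) (m + 1) : ℚ)
      = ((m : ℚ) + 1) * (m + 2) * (m + 3) * (3 * m + 8) / 24 := by
  induction m with
  | zero => norm_num [Nat.stirlingFirst]
  | succ m ih =>
    have h := stirlingFirst_add_two (m + 1)
    rw [show m + 1 + 3 = (m + 3) + 1 by ring, Nat.stirlingFirst_succ_succ]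
    rw [show m + 1 + 2 = m + 3 by ring] at h
    push_cast at h ⊢
    rw [ih, h]
    ring

/-- Along a fixed diagonal the Stirling recurrence has increments given by the preceding diagonal,
so each closed form follows from the previous one by induction. -/
theorem stirlingFirst_add_four (m : ℕ) :
    (Nat.stirlingFirst (m + 4) (m + 1) : ℚ)
      = ((m : ℚ) + 1) * (m + 2) * (m + 3) ^ 2 * (m + 4) ^ 2 / 48 := by
  induction m with
  | zero => norm_num [Nat.stirlingFirst]
  | succ m ih =>
    have h := stirlingFirst_add_three (m + 1)
    rw [show m + 1 + 4 = (m + 4) + 1 by ring, Nat.stirlingFirst_succ_succ]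
    rw [show m + 1 + 3 = m + 4 by ring] at h
    push_cast at h ⊢
    rw [ih, h]
    ring

theorem stirlingFirst_pos {n k : ℕ} (h : k < n) : 0 < Nat.stirlingFirst n (k + 1) := by
  induction n, h using Nat.le_induction with
  | base => simp [Nat.stirlingFirst_self]
  | succ n hn ih =>
    rw [Nat.stirlingFirst_succ_succ]
    have : 0 < n := by omega
    positivity

theorem bernoulli_two_mul_ne_zero {k : ℕ} (hk : k ≠ 0) : bernoulli (2 * k) ≠ 0 := by
  have h := abs_bernoulli_pos k hk
  intro h0
  simp [h0] at h

/-- Only the Stirling number can vanish, and it does so exactly when 2k < m + 1. -/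
theorem stieltjesTerm_ne_zero_iff (m : ℕ) {k : ℕ} (hk : 1 ≤ k) :
    stieltjesTerm m k ≠ 0 ↔ (m + 2) / 2 ≤ k := by
  constructor
  · intro h
    by_contra hlt
    refine h ?_
    rw [stieltjesTerm, Nat.stirlingFirst_eq_zero_of_lt (by omega)]
    simp
  · intro h
    have h1 := (stirlingFirst_pos (show m < 2 * k by omega)).ne'
    have h2 := bernoulli_two_mul_ne_zero (show k ≠ 0 by omega)
    have h3 := Nat.factorial_ne_zero m
    have h4 := Nat.factorial_ne_zero (2 * k)
    unfold stieltjesTerm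
    positivity

theorem stieltjesPartialSum_first (m : ℕ) :
    stieltjesPartialSum m ((m + 2) / 2) = stieltjesTerm m ((m + 2) / 2) := by
  refine Finset.sum_eq_single_of_mem _ (Finset.mem_Icc.mpr ⟨by omega, le_rfl⟩) fun k hk hne => ?_
  rw [Finset.mem_Icc] at hk
  by_contra h
  have := (stieltjesTerm_ne_zero_iff m hk.1).mp h
  omega

theorem stieltjesPartialSum_second (m : ℕ) :
    stieltjesPartialSum m ((m + 2) / 2 + 1)
      = stieltjesTerm m ((m + 2) / 2) + stieltjesTerm m ((m + 2) / 2 + 1) := by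
  rw [← stieltjesPartialSum_first, stieltjesPartialSum, stieltjesPartialSum,
    Finset.sum_Icc_succ_top (by omega)]

theorem bernoulli_two_mul_eq {k : ℕ} (hk : k ≠ 0) :
    bernoulli (2 * k) = (-1) ^ (k + 1) * |bernoulli (2 * k)| := by
  exact_mod_cast (abs_bernoulli_two_mul k hk).1

theorem stieltjesTerm_odd_first (k : ℕ) :
    stieltjesTerm (2 * k + 1) (k + 1) = (-1) ^ (k + 1) * (|bernoulli (2 * (k + 1))| / (2 * k + 2)) := by
  have hf : ((2 * (k + 1)).factorial : ℚ) = (2 * k + 2) * (2 * k + 1).factorial := by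
    rw [show 2 * (k + 1) = 2 * k + 1 + 1 by ring, Nat.factorial_succ]
    push_cast
    ring
  have hne : ((2 * k + 1).factorial : ℚ) ≠ 0 := by positivity
  rw [stieltjesTerm, bernoulli_two_mul_eq (by omega), hf,
    show Nat.stirlingFirst (2 * (k + 1)) (2 * k + 1 + 1) = 1 from Nat.stirlingFirst_self _,
    abs_mul, abs_pow, abs_neg, abs_one, one_pow, one_mul, abs_abs, pow_succ (-1 : ℚ) (2 * k), pow_mul]
  field_simp
  ring

theorem stieltjesTerm_odd_second (k : ℕ) :
    stieltjesTerm (2 * k + 1) (k + 2)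
      = (-1) ^ k * ((6 * k + 11) * |bernoulli (2 * (k + 2))| / 24) := by
  have hf : ((2 * (k + 2)).factorial : ℚ)
      = (2 * k + 4) * ((2 * k + 3) * ((2 * k + 2) * (2 * k + 1).factorial)) := by
    rw [show 2 * (k + 2) = 2 * k + 1 + 1 + 1 + 1 by ring, Nat.factorial_succ, Nat.factorial_succ,
      Nat.factorial_succ]
    push_cast
    ring
  have hne : ((2 * k + 1).factorial : ℚ) ≠ 0 := by positivity
  have hs := stirlingFirst_add_three (2 * k + 1)
  rw [show 2 * k + 1 + 3 = 2 * (k + 2) by ring] at hs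
  rw [stieltjesTerm, bernoulli_two_mul_eq (by omega), hf, hs,
    abs_mul, abs_pow, abs_neg, abs_one, one_pow, one_mul, abs_abs, pow_succ (-1 : ℚ) (2 * k), pow_mul,
    show k + 2 + 1 = k + 3 by ring, pow_add (-1 : ℚ) k 3]
  push_cast
  field_simp
  ring

theorem stieltjesTerm_even_first (k : ℕ) :
    stieltjesTerm (2 * k) (k + 1) = (-1) ^ k * (|bernoulli (2 * (k + 1))| / 2) := by
  have hf : ((2 * (k + 1)).factorial : ℚ) = (2 * k + 2) * ((2 * k + 1) * (2 * k).factorial) := by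
    rw [show 2 * (k + 1) = 2 * k + 1 + 1 by ring, Nat.factorial_succ, Nat.factorial_succ]
    push_cast
    ring
  have hne : ((2 * k).factorial : ℚ) ≠ 0 := by positivity
  have hs := stirlingFirst_add_two (2 * k)
  rw [show 2 * k + 2 = 2 * (k + 1) by ring] at hs
  rw [stieltjesTerm, bernoulli_two_mul_eq (by omega), hf, hs,
    abs_mul, abs_pow, abs_neg, abs_one, one_pow, one_mul, abs_abs, pow_mul,
    show k + 1 + 1 = k + 2 by ring, pow_add (-1 : ℚ) k 2]
  push_cast
  field_simp
  ring

theorem stieltjesTerm_even_second (k : ℕ) :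
    stieltjesTerm (2 * k) (k + 2)
      = (-1) ^ (k + 1) * ((2 * k + 3) * (2 * k + 4) * |bernoulli (2 * (k + 2))| / 48) := by
  have hf : ((2 * (k + 2)).factorial : ℚ)
      = (2 * k + 4) * ((2 * k + 3) * ((2 * k + 2) * ((2 * k + 1) * (2 * k).factorial))) := by
    rw [show 2 * (k + 2) = 2 * k + 1 + 1 + 1 + 1 by ring, Nat.factorial_succ, Nat.factorial_succ,
      Nat.factorial_succ, Nat.factorial_succ]
    push_cast
    ring
  have hne : ((2 * k).factorial : ℚ) ≠ 0 := by positivity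
  have hs := stirlingFirst_add_four (2 * k)
  rw [show 2 * k + 4 = 2 * (k + 2) by ring] at hs
  rw [stieltjesTerm, bernoulli_two_mul_eq (by omega), hf, hs,
    abs_mul, abs_pow, abs_neg, abs_one, one_pow, one_mul, abs_abs, pow_mul,
    show k + 2 + 1 = k + 1 + 2 by ring, pow_add (-1 : ℚ) (k + 1) 2]
  push_cast
  field_simp
  ring

theorem stieltjesPartialSum_odd (k : ℕ) :
    stieltjesPartialSum (2 * k + 1) ((2 * k + 1 + 2) / 2)
      = (-1) ^ (k + 1) * (|bernoulli (2 * (k + 1))| / (2 * k + 2)) ∧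
    stieltjesPartialSum (2 * k + 1) ((2 * k + 1 + 2) / 2 + 1)
      = (-1) ^ (k + 1) * (|bernoulli (2 * (k + 1))| / (2 * k + 2))
        + (-1) ^ k * ((6 * k + 11) * |bernoulli (2 * (k + 2))| / 24) := by
  rw [stieltjesPartialSum_first, stieltjesPartialSum_second,
    show (2 * k + 1 + 2) / 2 = k + 1 by omega, stieltjesTerm_odd_first, stieltjesTerm_odd_second]
  exact ⟨rfl, rfl⟩

theorem stieltjesPartialSum_even (k : ℕ) :
    stieltjesPartialSum (2 * k) ((2 * k + 2) / 2)
      = (-1) ^ k * (|bernoulli (2 * (k + 1))| / 2) ∧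
    stieltjesPartialSum (2 * k) ((2 * k + 2) / 2 + 1)
      = (-1) ^ k * (|bernoulli (2 * (k + 1))| / 2)
        + (-1) ^ (k + 1) * ((2 * k + 3) * (2 * k + 4) * |bernoulli (2 * (k + 2))| / 48) := by
  rw [stieltjesPartialSum_first, stieltjesPartialSum_second,
    show (2 * k + 2) / 2 = k + 1 by omega, stieltjesTerm_even_first, stieltjesTerm_even_second]
  exact ⟨rfl, rfl⟩

/-! ### The exceptional cases and the final assembly -/

theorem stieltjesConstant_one_lt :
    stieltjesConstant 1 < 11 * |(bernoulli 4 : ℝ)| / 24 - |(bernoulli 2 : ℝ)| / 2 := by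
  have h := stieltjesConstant_lt_of_jensenFun_lt (m := 1) (k := 0) (l := 1) (a := -2) (b := 11 / 3)
    fun x hx => by simpa using jensenFun_one_lt hx
  norm_num at h ⊢
  linarith

theorem stieltjesConstant_two_lt :
    stieltjesConstant 2 < 5 * 6 * |(bernoulli 6 : ℝ)| / 48 - |(bernoulli 4 : ℝ)| / 2 := by
  have h := stieltjesConstant_lt_of_jensenFun_lt (m := 2) (k := 1) (l := 2) (a := -4) (b := 15 / 2)
    fun x hx => by simpa using jensenFun_two_lt hx
  norm_num at h ⊢
  linarith

theorem lt_stieltjesConstant_zero :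
    |(bernoulli 2 : ℝ)| / 2 - 3 * 4 * |(bernoulli 4 : ℝ)| / 48 < stieltjesConstant 0 - 1 / 2 := by
  have h := lt_stieltjesConstant_of_lt_jensenFun (m := 0) (k := 0) (l := 1) (a := 2) (b := -2)
    fun x hx => by simpa [← sub_eq_add_neg] using lt_jensenFun_zero hx
  norm_num at h ⊢
  linarith

theorem mainTheorem4 :
    -- closed forms of the unsigned Stirling numbers of the first kind next to the diagonal
    (∀ m : ℕ,
      (Nat.stirlingFirst (m + 1) (m + 1) : ℚ) = 1 ∧
      (Nat.stirlingFirst (m + 2) (m + 1) : ℚ) = ((m : ℚ) + 1) * (m + 2) / 2 ∧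
      (Nat.stirlingFirst (m + 3) (m + 1) : ℚ)
        = ((m : ℚ) + 1) * (m + 2) * (m + 3) * (3 * m + 8) / 24 ∧
      (Nat.stirlingFirst (m + 4) (m + 1) : ℚ)
        = ((m : ℚ) + 1) * (m + 2) * (m + 3) ^ 2 * (m + 4) ^ 2 / 48) ∧
    -- the first nonvanishing term of the series has index `⌈(m + 1) / 2⌉ = (m + 2) / 2`
    (∀ m k : ℕ, 1 ≤ k → (stieltjesTerm m k ≠ 0 ↔ (m + 2) / 2 ≤ k)) ∧
    -- the first two nonvanishing partial sums, and the bounds that they give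
    (∀ m : ℕ, m % 4 = 1 →
      stieltjesPartialSum m ((m + 2) / 2) = -(|bernoulli (m + 1)| / (m + 1)) ∧
      stieltjesPartialSum m ((m + 2) / 2 + 1)
        = (3 * m + 8) * |bernoulli (m + 3)| / 24 - |bernoulli (m + 1)| / (m + 1) ∧
      ((-(|bernoulli (m + 1)| / (m + 1)) : ℚ) : ℝ) < stieltjesConstant m ∧
      stieltjesConstant m
        < (((3 * m + 8) * |bernoulli (m + 3)| / 24 - |bernoulli (m + 1)| / (m + 1) : ℚ) : ℝ)) ∧
    (∀ m : ℕ, m % 4 = 3 →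
      stieltjesPartialSum m ((m + 2) / 2) = |bernoulli (m + 1)| / (m + 1) ∧
      stieltjesPartialSum m ((m + 2) / 2 + 1)
        = |bernoulli (m + 1)| / (m + 1) - (3 * m + 8) * |bernoulli (m + 3)| / 24 ∧
      ((|bernoulli (m + 1)| / (m + 1) - (3 * m + 8) * |bernoulli (m + 3)| / 24 : ℚ) : ℝ)
        < stieltjesConstant m ∧
      stieltjesConstant m < ((|bernoulli (m + 1)| / (m + 1) : ℚ) : ℝ)) ∧
    (∀ m : ℕ, m % 4 = 2 →
      stieltjesPartialSum m ((m + 2) / 2) = -(|bernoulli (m + 2)| / 2) ∧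
      stieltjesPartialSum m ((m + 2) / 2 + 1)
        = (m + 3) * (m + 4) * |bernoulli (m + 4)| / 48 - |bernoulli (m + 2)| / 2 ∧
      ((-(|bernoulli (m + 2)| / 2) : ℚ) : ℝ) < stieltjesConstant m ∧
      stieltjesConstant m
        < (((m + 3) * (m + 4) * |bernoulli (m + 4)| / 48 - |bernoulli (m + 2)| / 2 : ℚ) : ℝ)) ∧
    -- for `m = 0` these are bounds for `γ₀ - 1 / 2`
    (∀ m : ℕ, m % 4 = 0 →
      stieltjesPartialSum m ((m + 2) / 2) = |bernoulli (m + 2)| / 2 ∧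
      stieltjesPartialSum m ((m + 2) / 2 + 1)
        = |bernoulli (m + 2)| / 2 - (m + 3) * (m + 4) * |bernoulli (m + 4)| / 48 ∧
      ((|bernoulli (m + 2)| / 2 - (m + 3) * (m + 4) * |bernoulli (m + 4)| / 48 : ℚ) : ℝ)
        < stieltjesConstant m - (if m = 0 then 1 / 2 else 0) ∧
      stieltjesConstant m - (if m = 0 then 1 / 2 else 0) < ((|bernoulli (m + 2)| / 2 : ℚ) : ℝ)) ∧
    -- in particular, for Euler's constant
    (23 / 40 : ℝ) < Real.eulerMascheroniConstant ∧
    Real.eulerMascheroniConstant < (7 / 12 : ℝ) := by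
  refine ⟨fun m => ⟨by simp [Nat.stirlingFirst_self], stirlingFirst_add_two m,
    stirlingFirst_add_three m, stirlingFirst_add_four m⟩,
    fun m k hk => stieltjesTerm_ne_zero_iff m hk, fun m hm => ?_, fun m hm => ?_, fun m hm => ?_,
    fun m hm => ?_, ?_, ?_⟩
  -- Writing the residue of `m` mod 4 through `j` fixes the parity that determines the signs of the
  -- two terms.
  · obtain ⟨j, rfl⟩ : ∃ j, m = 2 * (2 * j) + 1 := ⟨m / 4, by omega⟩
    obtain ⟨h1, h2⟩ := stieltjesPartialSum_odd (2 * j)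
    have h3 := abs_lt.mp (abs_stieltjesConstant_odd_lt (2 * j))
    rw [Even.neg_one_pow (even_two_mul j), Odd.neg_one_pow (odd_two_mul_add_one j)] at h2
    rw [Odd.neg_one_pow (odd_two_mul_add_one j)] at h1
    rw [h1, h2]
    simp only [show 2 * (2 * j) + 1 + 1 = 2 * (2 * j + 1) by ring,
      show 2 * (2 * j) + 1 + 3 = 2 * (2 * j + 2) by ring]
    push_cast at h3 ⊢
    refine ⟨by ring, by ring, ?_, ?_⟩
    · refine lt_of_eq_of_lt ?_ h3.1
      ring
    -- j = 0 is the exceptional m = 1. Otherwise, with A and B the sizes of the first and second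
    -- terms, γ_m < A ≤ B - A because 2A ≤ B.
    · rcases Nat.eq_zero_or_pos j with rfl | hj
      · have := stieltjesConstant_one_lt
        norm_num at this ⊢
        exact this
      · have h4 := two_mul_first_term_le_odd (2 * j) (by omega)
        push_cast at h4
        rw [show (2 : ℝ) * (2 * j) + 1 + 1 = 2 * (2 * j) + 2 by ring]
        linarith [h3.2]
  · obtain ⟨j, rfl⟩ : ∃ j, m = 2 * (2 * j + 1) + 1 := ⟨m / 4, by omega⟩
    obtain ⟨h1, h2⟩ := stieltjesPartialSum_odd (2 * j + 1)
    have h3 := abs_lt.mp (abs_stieltjesConstant_odd_lt (2 * j + 1))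
    have h4 := two_mul_first_term_le_odd (2 * j + 1) (by omega)
    have he : Even (2 * j + 1 + 1) := ⟨j + 1, by ring⟩
    rw [Even.neg_one_pow he, Odd.neg_one_pow (odd_two_mul_add_one j)] at h2
    rw [Even.neg_one_pow he] at h1
    rw [h1, h2]
    simp only [show 2 * (2 * j + 1) + 1 + 1 = 2 * (2 * j + 1 + 1) by ring,
      show 2 * (2 * j + 1) + 1 + 3 = 2 * (2 * j + 1 + 2) by ring]
    push_cast at h3 h4 ⊢
    rw [show (2 : ℝ) * (2 * j + 1) + 1 + 1 = 2 * (2 * j + 1) + 2 by ring]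
    exact ⟨by ring, by ring, by linarith [h3.1], h3.2⟩
  · obtain ⟨j, rfl⟩ : ∃ j, m = 2 * (2 * j + 1) := ⟨m / 4, by omega⟩
    obtain ⟨h1, h2⟩ := stieltjesPartialSum_even (2 * j + 1)
    have h3 := abs_lt.mp (abs_stieltjesConstant_even_lt (2 * j + 1))
    rw [if_neg (by omega), sub_zero] at h3
    have he : Even (2 * j + 1 + 1) := ⟨j + 1, by ring⟩
    rw [Even.neg_one_pow he, Odd.neg_one_pow (odd_two_mul_add_one j)] at h2
    rw [Odd.neg_one_pow (odd_two_mul_add_one j)] at h1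
    rw [h1, h2]
    simp only [show 2 * (2 * j + 1) + 2 = 2 * (2 * j + 1 + 1) by ring,
      show 2 * (2 * j + 1) + 4 = 2 * (2 * j + 1 + 2) by ring]
    push_cast at h3 ⊢
    refine ⟨by ring, by ring, h3.1, ?_⟩
    rcases Nat.eq_zero_or_pos j with rfl | hj
    · have := stieltjesConstant_two_lt
      norm_num at this ⊢
      exact this
    · have h4 := two_mul_first_term_le_even (2 * j + 1) (by omega)
      push_cast at h4
      linarith [h3.2]
  · obtain ⟨j, rfl⟩ : ∃ j, m = 2 * (2 * j) := ⟨m / 4, by omega⟩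
    obtain ⟨h1, h2⟩ := stieltjesPartialSum_even (2 * j)
    have h3 := abs_lt.mp (abs_stieltjesConstant_even_lt (2 * j))
    rw [Even.neg_one_pow (even_two_mul j), Odd.neg_one_pow (odd_two_mul_add_one j)] at h2
    rw [Even.neg_one_pow (even_two_mul j)] at h1
    rw [h1, h2]
    simp only [show 2 * (2 * j) + 2 = 2 * (2 * j + 1) by ring,
      show 2 * (2 * j) + 4 = 2 * (2 * j + 2) by ring]
    refine ⟨by ring, by push_cast; ring, ?_, by push_cast; exact h3.2⟩
    rcases Nat.eq_zero_or_pos j with rfl | hj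
    · have := lt_stieltjesConstant_zero
      norm_num at this ⊢
      exact this
    · have h4 := two_mul_first_term_le_even (2 * j) (by omega)
      push_cast at h4 ⊢
      linarith [h3.1]
  -- With B_2 = 1/6 and B_4 = -1/30: 1/2 + 1/12 - 1/120 = 23/40.
  · have h := lt_stieltjesConstant_zero
    rw [stieltjesConstant_zero, bernoulli_two, bernoulli_four_eq] at h
    norm_num [abs_of_pos, abs_of_neg] at h
    linarith
  · have h := (abs_lt.mp (abs_stieltjesConstant_even_lt 0)).2
    norm_num [stieltjesConstant_zero, bernoulli_two, abs_of_pos] at h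
    linarith
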